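/- Let $\mathsf{RCA}_0^\omega=\mathsf{E\text{-}PRA}^\omega+\mathsf{QF\text{-}AC}^{1,0}$ be Kohlenbach's classical base theory in all finite types (type $0$ for the natural numbers, $1=0\to 0$, $2=1\to 0$): it has equality at type $0$, zero and successor, the combinators $\Pi,\Sigma$, the recursor $R_0$ of type $0$, extensionality at all types, quantifier-free induction, and choice from type $1$ to type $0$ for quantifier-free formulas. Sets are given by binary characteristic functions of type $1$. For $\mu^{2}$ let $\mathsf{MU}(\mu)$ be $$(\forall f^{1})\big[(\exists n^0) f(n)=0\rightarrow f(\mu(f))=0\big],$$ and let $(\mu^2)$ be $(\exists\mu^2)\,\mathsf{MU}(\mu)$. For $\Phi=(\Phi_1,\Phi_2)$ of type $(0\to1)\to(1\times1)$ let $\mathsf{UCOH}(\Phi)$ state that for every sequence of sets $R^{0\to1}$, $\Phi_1(R)$ is a set with $$(\forall k^0)(\exists l^0>k)[l\in\Phi_1(R)]\ \wedge\ (\forall i^0)\Big[(\forall n\in\Phi_1(R))(n\ge\Phi_2(R)(i)\to n\in R(i))\ \vee\ (\forall m\in\Phi_1(R))(m\ge\Phi_2(R)(i)\to m\notin R(i))\Big],$$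 and let $\mathsf{UCOH}$ be $(\exists\Phi)\,\mathsf{UCOH}(\Phi)$. For $\Xi$ of type $(0\to1)\to1$ let $\mathsf{INF}(\Phi,\Xi)$ state that $\Xi(R)(k)>k$ and $\Xi(R)(k)\in\Phi_1(R)$ for every sequence of sets $R^{0\to1}$ and every $k^0$. Theorem. $\mathsf{RCA}_0^\omega$ proves $\mathsf{UCOH}\leftrightarrow(\mu^2)$, and the equivalence is explicit in the following sense. 1. There are closed terms $s_1,s_2$ of the language such that $\mathsf{RCA}_0^\omega$ proves $(\forall\mu^2)\big[\mathsf{MU}(\mu)\rightarrow\mathsf{UCOH}(s_1(\mu),s_2(\mu))\big]$. 2. $\mathsf{RCA}_0^\omega$ proves $(\forall\Phi)\big[\mathsf{UCOH}(\Phi)\rightarrow(\exists\Xi)\,\mathsf{INF}(\Phi,\Xi)\big]$, and there is a closed term $u$ of the language such that $\mathsf{RCA}_0^\omega$ proves $(\forall\Phi,\Xi)\big[\mathsf{UCOH}(\Phi)\wedge\mathsf{INF}(\Phi,\Xi)\rightarrow\mathsf{MU}(u(\Phi,\Xi))\big]$. -/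

import Mathlib

/-! Kohlenbach's base theory of higher-order reverse mathematics: the finite types, the terms and
formulas of the language, classical natural deduction, and the axioms. -/

namespace HigherOrderArith

/-- The finite types: the type `0` of natural numbers and the function types. -/
inductive Ty : Type
  | nat : Ty
  | arrow : Ty → Ty → Ty

infixr:60 " ⇒ " => Ty.arrow

/-- Type `1`, i.e. `0 → 0`. -/
abbrev Ty.one : Ty := Ty.nat ⇒ Ty.nat

/-- Type `2`, i.e. `1 → 0`. -/
abbrev Ty.two : Ty := Ty.one ⇒ Ty.nat

/-- The type `0 → 1` of sequences of type `1` objects. -/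
abbrev Ty.seq : Ty := Ty.nat ⇒ Ty.one

/-- A context lists the types of the free variables. -/
abbrev Ctx : Type := List Ty

/-- Typed de Bruijn variables. -/
inductive Var : Ctx → Ty → Type
  | here {Γ : Ctx} {ρ : Ty} : Var (ρ :: Γ) ρ
  | there {Γ : Ctx} {ρ σ : Ty} : Var Γ ρ → Var (σ :: Γ) ρ

/-- Terms: variables, the constants `0`, `S`, the combinators `Π`, `Σ`, the recursor `R₀` of
type `0`, and application. (Recursors for type `0` with parameters of higher type, in which the
values are of type `0` after all arguments are supplied, are definable from `R₀`, `Π`, `Σ`.) -/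
inductive Term : Ctx → Ty → Type
  | var {Γ : Ctx} {ρ : Ty} : Var Γ ρ → Term Γ ρ
  | zero {Γ : Ctx} : Term Γ Ty.nat
  | succ {Γ : Ctx} : Term Γ (Ty.nat ⇒ Ty.nat)
  | combK {Γ : Ctx} (ρ τ : Ty) : Term Γ (ρ ⇒ τ ⇒ ρ)
  | combS {Γ : Ctx} (δ ρ τ : Ty) : Term Γ ((δ ⇒ ρ ⇒ τ) ⇒ (δ ⇒ ρ) ⇒ δ ⇒ τ)
  | recN {Γ : Ctx} : Term Γ (Ty.nat ⇒ Ty.nat ⇒ (Ty.nat ⇒ Ty.nat ⇒ Ty.nat) ⇒ Ty.nat)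
  | app {Γ : Ctx} {ρ τ : Ty} : Term Γ (ρ ⇒ τ) → Term Γ ρ → Term Γ τ

infixl:75 " ⬝ " => Term.app

/-- A simultaneous substitution of terms over `Δ` for the variables of `Γ`. -/
abbrev Subst (Γ Δ : Ctx) : Type := ∀ ρ : Ty, Var Γ ρ → Term Δ ρ

/-- Simultaneous substitution in a term. -/
def Term.subst {Γ Δ : Ctx} (σ : Subst Γ Δ) : {ρ : Ty} → Term Γ ρ → Term Δ ρ
  | _, .var x => σ _ x
  | _, .zero => .zero
  | _, .succ => .succ
  | _, .combK ρ τ => .combK ρ τ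
  | _, .combS δ ρ τ => .combS δ ρ τ
  | _, .recN => .recN
  | _, .app t s => .app (t.subst σ) (s.subst σ)

/-- The substitution that shifts every variable by one. -/
def Subst.shift {Γ : Ctx} {ρ : Ty} : Subst Γ (ρ :: Γ) := fun _ x => .var (.there x)

/-- Weakening of a term by one new variable. -/
def Term.wk {Γ : Ctx} {ρ τ : Ty} (t : Term Γ τ) : Term (ρ :: Γ) τ := t.subst Subst.shift

/-- Extend a substitution by a term for the newest variable. -/
def Subst.cons {Γ Δ : Ctx} {ρ : Ty} (t : Term Δ ρ) (σ : Subst Γ Δ) : Subst (ρ :: Γ) Δ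
  | _, .here => t
  | _, .there x => σ _ x

/-- Carry a substitution under a quantifier. -/
def Subst.lift {Γ Δ : Ctx} {ρ : Ty} (σ : Subst Γ Δ) : Subst (ρ :: Γ) (ρ :: Δ) :=
  Subst.cons (.var .here) (fun _ x => (σ _ x).wk)

/-- The identity substitution. -/
def Subst.id {Γ : Ctx} : Subst Γ Γ := fun _ x => .var x

/-- Formulas: equations between terms of type `0`, falsum, implication, and universal
quantification over every finite type. The other connectives are defined classically. -/
inductive Formula : Ctx → Type
  | eq {Γ : Ctx} : Term Γ Ty.nat → Term Γ Ty.nat → Formula Γ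
  | falsum {Γ : Ctx} : Formula Γ
  | imp {Γ : Ctx} : Formula Γ → Formula Γ → Formula Γ
  | all {Γ : Ctx} (ρ : Ty) : Formula (ρ :: Γ) → Formula Γ

namespace Formula

/-- Capture-avoiding simultaneous substitution. -/
def subst : {Γ Δ : Ctx} → Subst Γ Δ → Formula Γ → Formula Δ
  | _, _, σ, .eq t s => .eq (t.subst σ) (s.subst σ)
  | _, _, _, .falsum => .falsum
  | _, _, σ, .imp φ ψ => .imp (φ.subst σ) (ψ.subst σ)
  | _, _, σ, .all ρ φ => .all ρ (φ.subst σ.lift)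

/-- Weakening of a formula by one new variable. -/
def wk {Γ : Ctx} {ρ : Ty} (φ : Formula Γ) : Formula (ρ :: Γ) := φ.subst Subst.shift

/-- `φ[t]`: the newest variable is replaced by `t`. -/
def inst {Γ : Ctx} {ρ : Ty} (φ : Formula (ρ :: Γ)) (t : Term Γ ρ) : Formula Γ :=
  φ.subst (Subst.cons t Subst.id)

/-- Negation. -/
def neg {Γ : Ctx} (φ : Formula Γ) : Formula Γ := .imp φ .falsum

/-- Disjunction. -/
def or {Γ : Ctx} (φ ψ : Formula Γ) : Formula Γ := .imp φ.neg ψ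

/-- Conjunction. -/
def and {Γ : Ctx} (φ ψ : Formula Γ) : Formula Γ := (Formula.imp φ ψ.neg).neg

/-- Bi-implication. -/
def iff {Γ : Ctx} (φ ψ : Formula Γ) : Formula Γ := (Formula.imp φ ψ).and (Formula.imp ψ φ)

/-- Existential quantification. -/
def ex {Γ : Ctx} (ρ : Ty) (φ : Formula (ρ :: Γ)) : Formula Γ := (Formula.all ρ φ.neg).neg

/-- Quantifier-free formulas (parameters of all types are allowed). -/
def IsQF : {Γ : Ctx} → Formula Γ → Prop
  | _, .eq _ _ => True
  | _, .falsum => True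
  | _, .imp φ ψ => φ.IsQF ∧ ψ.IsQF
  | _, .all _ _ => False

end Formula

/-- The newest variable. -/
abbrev v0 {Γ : Ctx} {ρ : Ty} : Term (ρ :: Γ) ρ := .var .here

/-- The second newest variable. -/
abbrev v1 {Γ : Ctx} {ρ σ : Ty} : Term (σ :: ρ :: Γ) ρ := .var (.there .here)

/-- The third newest variable. -/
abbrev v2 {Γ : Ctx} {ρ σ τ : Ty} : Term (τ :: σ :: ρ :: Γ) ρ := .var (.there (.there .here))

/-- Equality at type `ρ`: pointwise equality, down to equality of numbers. -/
def eqAt : {Γ : Ctx} → (ρ : Ty) → Term Γ ρ → Term Γ ρ → Formula Γ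
  | _, .nat, t, s => .eq t s
  | _, .arrow ρ τ, t, s => .all ρ (eqAt τ (t.wk ⬝ v0) (s.wk ⬝ v0))

/-- The non-logical axioms of `RCA₀^ω = E-PRA^ω + QF-AC^{1,0}`, in every context: successor
axioms, defining axioms of the combinators and of the recursor, extensionality at all types,
quantifier-free induction, and quantifier-free choice from type `1` to type `0`. -/
inductive RCAωAxiom : (Γ : Ctx) → Formula Γ → Prop
  | succ_ne_zero (Γ : Ctx) :
      RCAωAxiom Γ (.all .nat (Formula.eq (.succ ⬝ v0) .zero).neg)
  | succ_inj (Γ : Ctx) :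
      RCAωAxiom Γ (.all .nat (.all .nat (.imp (.eq (.succ ⬝ v1) (.succ ⬝ v0)) (.eq v1 v0))))
  | combK (Γ : Ctx) (ρ τ : Ty) :
      RCAωAxiom Γ (.all ρ (.all τ (eqAt ρ (.combK ρ τ ⬝ v1 ⬝ v0) v1)))
  | combS (Γ : Ctx) (δ ρ τ : Ty) :
      RCAωAxiom Γ (.all (δ ⇒ ρ ⇒ τ) (.all (δ ⇒ ρ) (.all δ
        (eqAt τ (.combS δ ρ τ ⬝ v2 ⬝ v1 ⬝ v0) (v2 ⬝ v0 ⬝ (v1 ⬝ v0))))))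
  | rec_zero (Γ : Ctx) :
      RCAωAxiom Γ (.all .nat (.all (.nat ⇒ .nat ⇒ .nat)
        (.eq (.recN ⬝ .zero ⬝ v1 ⬝ v0) v1)))
  | rec_succ (Γ : Ctx) :
      RCAωAxiom Γ (.all .nat (.all .nat (.all (.nat ⇒ .nat ⇒ .nat)
        (.eq (.recN ⬝ (.succ ⬝ v2) ⬝ v1 ⬝ v0) (v0 ⬝ (.recN ⬝ v2 ⬝ v1 ⬝ v0) ⬝ v2)))))
  | ext (Γ : Ctx) (ρ τ : Ty) :
      RCAωAxiom Γ (.all (ρ ⇒ τ) (.all ρ (.all ρ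
        (.imp (eqAt ρ v1 v0) (eqAt τ (v2 ⬝ v1) (v2 ⬝ v0))))))
  | qfInd (Γ : Ctx) (φ : Formula (.nat :: Γ)) (hφ : φ.IsQF) :
      RCAωAxiom Γ (.imp (φ.inst .zero)
        (.imp (.all .nat (.imp φ (φ.subst (Subst.cons (.succ ⬝ v0) Subst.shift))))
          (.all .nat φ)))
  | qfAC (Γ : Ctx) (φ : Formula (.nat :: .one :: Γ)) (hφ : φ.IsQF) :
      RCAωAxiom Γ (.imp (.all .one (.ex .nat φ))
        (.ex .two (.all .one (φ.subst
          (Subst.cons (v1 ⬝ v0) (Subst.cons v0 fun _ x => .var (.there (.there x))))))))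

/-- Classical many-sorted natural deduction with equality at type `0`, from the axioms `Ax` and
a finite list of hypotheses. -/
inductive Derivable (Ax : (Γ : Ctx) → Formula Γ → Prop) :
    {Γ : Ctx} → List (Formula Γ) → Formula Γ → Prop
  | ax {Γ : Ctx} {H : List (Formula Γ)} {φ : Formula Γ} : Ax Γ φ → Derivable Ax H φ
  | hyp {Γ : Ctx} {H : List (Formula Γ)} {φ : Formula Γ} : φ ∈ H → Derivable Ax H φ
  | impI {Γ : Ctx} {H : List (Formula Γ)} {φ ψ : Formula Γ} :
      Derivable Ax (φ :: H) ψ → Derivable Ax H (.imp φ ψ)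
  | impE {Γ : Ctx} {H : List (Formula Γ)} {φ ψ : Formula Γ} :
      Derivable Ax H (.imp φ ψ) → Derivable Ax H φ → Derivable Ax H ψ
  | byContra {Γ : Ctx} {H : List (Formula Γ)} {φ : Formula Γ} :
      Derivable Ax (φ.neg :: H) .falsum → Derivable Ax H φ
  | allI {Γ : Ctx} {H : List (Formula Γ)} {ρ : Ty} {φ : Formula (ρ :: Γ)} :
      Derivable Ax (H.map Formula.wk) φ → Derivable Ax H (.all ρ φ)
  | allE {Γ : Ctx} {H : List (Formula Γ)} {ρ : Ty} {φ : Formula (ρ :: Γ)} (t : Term Γ ρ) :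
      Derivable Ax H (.all ρ φ) → Derivable Ax H (φ.inst t)
  | eqRefl {Γ : Ctx} {H : List (Formula Γ)} (t : Term Γ Ty.nat) : Derivable Ax H (.eq t t)
  | eqSubst {Γ : Ctx} {H : List (Formula Γ)} {t s : Term Γ Ty.nat}
      (φ : Formula (Ty.nat :: Γ)) :
      Derivable Ax H (.eq t s) → Derivable Ax H (φ.inst t) → Derivable Ax H (φ.inst s)

/-- `RCA₀^ω ⊢ φ`, for a sentence `φ`. -/
def RCAωProves (φ : Formula []) : Prop := Derivable RCAωAxiom [] φ

section Principles

variable {Γ : Ctx}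

/-- The numeral `1`. -/
def oneT : Term Γ Ty.nat := .succ ⬝ .zero

/-- The identity combinator at type `0`. -/
def idT : Term Γ (Ty.nat ⇒ Ty.nat) :=
  .combS .nat (.nat ⇒ .nat) .nat ⬝ .combK .nat (.nat ⇒ .nat) ⬝ .combK .nat .nat

/-- The function `u, x ↦ x`. -/
def sndT : Term Γ (Ty.nat ⇒ Ty.nat ⇒ Ty.nat) := .combK (.nat ⇒ .nat) .nat ⬝ idT

/-- Predecessor, `x ↦ R₀ x 0 (u, y ↦ y)`. -/
def predT : Term Γ (Ty.nat ⇒ Ty.nat) :=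
  .combS .nat (.nat ⇒ .nat ⇒ .nat) .nat
    ⬝ (.combS .nat .nat ((.nat ⇒ .nat ⇒ .nat) ⇒ .nat) ⬝ .recN ⬝ (.combK .nat .nat ⬝ .zero))
    ⬝ (.combK (.nat ⇒ .nat ⇒ .nat) .nat ⬝ sndT)

/-- Truncated subtraction `s ∸ t`, i.e. `R₀ t s (u, y ↦ pred u)`. -/
def subT (s t : Term Γ Ty.nat) : Term Γ Ty.nat :=
  .recN ⬝ t ⬝ s ⬝
    (.combS .nat .nat (.nat ⇒ .nat)
      ⬝ (.combK (.nat ⇒ .nat ⇒ .nat) .nat ⬝ .combK .nat .nat) ⬝ predT)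

/-- `s ≤ t`. -/
def le (s t : Term Γ Ty.nat) : Formula Γ := .eq (subT s t) .zero

/-- `s < t`. -/
def lt (s t : Term Γ Ty.nat) : Formula Γ := le (.succ ⬝ s) t

/-- `n ∈ X`, where `X` is given by its characteristic function. -/
def mem (n : Term Γ Ty.nat) (X : Term Γ Ty.one) : Formula Γ := .eq (X ⬝ n) oneT

/-- `X` is a set: its characteristic function is binary. -/
def isSet (X : Term Γ Ty.one) : Formula Γ :=
  .all .nat ((Formula.eq (X.wk ⬝ v0) .zero).or (.eq (X.wk ⬝ v0) oneT))

/-- `R` is a sequence of sets. -/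
def isSetSeq (R : Term Γ Ty.seq) : Formula Γ := .all .nat (isSet (R.wk ⬝ v0))

/-- `X` is infinite: for all `k` there is `l > k` with `l ∈ X`. -/
def isInfinite (X : Term Γ Ty.one) : Formula Γ :=
  .all .nat (.ex .nat ((lt v1 v0).and (mem v0 X.wk.wk)))

/-- `C` is an infinite set and for each `i`, either every `n ∈ C` with `n ≥ b i` is in `R i`,
or every `m ∈ C` with `m ≥ b i` is in the complement of `R i`. -/
def isCohesive (R : Term Γ Ty.seq) (C b : Term Γ Ty.one) : Formula Γ :=
  (isSet C).and ((isInfinite C).and (.all .nat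
    (Formula.or
      (.all .nat (.imp (mem v0 C.wk.wk)
        (.imp (le (b.wk.wk ⬝ v1) v0) (mem v0 (R.wk.wk ⬝ v1)))))
      (.all .nat (.imp (mem v0 C.wk.wk)
        (.imp (le (b.wk.wk ⬝ v1) v0) (mem v0 (R.wk.wk ⬝ v1)).neg))))))

/-- `UCOH(Φ)`. The functional `Φ` of type `(0 → 1) → (1 × 1)` is the pair of its components `Φ₁`
and `Φ₂`, so that `Φ(R)(1)` is `Φ₁ R` and `Φ(R)(2)` is `Φ₂ R`. -/
def UCOHFor (Φ₁ Φ₂ : Term Γ (Ty.seq ⇒ Ty.one)) : Formula Γ :=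
  .all .seq (.imp (isSetSeq v0) (isCohesive v0 (Φ₁.wk ⬝ v0) (Φ₂.wk ⬝ v0)))

/-- The principle `UCOH`. -/
def UCOH : Formula Γ :=
  .ex (.seq ⇒ .one) (.ex (.seq ⇒ .one) (UCOHFor v1 v0))

/-- `MU(μ)`: for all `f`, if `f n = 0` for some `n`, then `f (μ f) = 0`. -/
def MUFor (μ : Term Γ Ty.two) : Formula Γ :=
  .all .one (.imp (.ex .nat (.eq (v1 ⬝ v0) .zero)) (.eq (v0 ⬝ (μ.wk ⬝ v0)) .zero))

/-- The principle `(μ²)`. -/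
def Mu2 : Formula Γ := .ex .two (MUFor v0)

/-- `Ξ` witnesses that the sets `Φ₁ R` are infinite: for every sequence of sets `R` and every `k`,
`Ξ R k > k` and `Ξ R k ∈ Φ₁ R`. -/
def InfWitness (Φ₁ Ξ : Term Γ (Ty.seq ⇒ Ty.one)) : Formula Γ :=
  .all .seq (.imp (isSetSeq v0) (.all .nat
    ((lt v0 (Ξ.wk.wk ⬝ v1 ⬝ v0)).and (mem (Ξ.wk.wk ⬝ v1 ⬝ v0) (Φ₁.wk.wk ⬝ v1)))))

end Principles

end HigherOrderArith

open HigherOrderArith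

/-! Derivability is obtained semantically. By a Henkin construction, a sentence true in every
extensional model of the axioms is derivable, so it suffices to argue inside an arbitrary, possibly
nonstandard, model `M`. Elements of type `0` need not be standard there, and induction is available
only for quantifier-free formulas with parameters. All arithmetic must respect this.

From `UCOH` to `(μ²)` (`isMu_of_isUCOH`): given `f`, take the constant sequence whose term is the
set of `n` bounding some zero of `f`. This set is empty or a final segment. An infinite cohesive set
`C` with bound `b` decides which: if `f` has a zero, `C` cannot avoid the set beyond `b 0`, so any
element of `C` beyond `b 0` bounds a zero, and bounded search below it finds one. Such an element is
what `Ξ` supplies. To get `Ξ` itself (`exists_isInfWitness`), a pair of a sequence of sets and a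
number is coded as one type `1` object, so that choice from type `1` to type `0` applies.

From `(μ²)` to `UCOH` (`isCohesive_cohSetT`): `μ` turns every arithmetical predicate into a term.
Repeated pigeonhole then yields a strictly increasing sequence `c` such that `c (i+1)` agrees with
`c i` on `R j` for all `j < i`, while infinitely many numbers agree with `c (i+1)` on `R j` for all
`j ≤ i`. Its range is cohesive, with bound `c (i+1)` for `R i`. -/

namespace HigherOrderArith

/-! ### Substitution calculus and closure of derivability under substitution -/

namespace Subst

/-- Composition of substitutions. -/
def comp {Γ Δ Θ : Ctx} (σ : Subst Γ Δ) (τ : Subst Δ Θ) : Subst Γ Θ :=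
  fun _ x => (σ _ x).subst τ

end Subst

namespace Term

theorem subst_subst {Γ Δ Θ : Ctx} (σ : Subst Γ Δ) (τ : Subst Δ Θ) {ρ : Ty} (t : Term Γ ρ) :
    (t.subst σ).subst τ = t.subst (σ.comp τ) := by
  induction t with
  | app t s iht ihs => simp only [Term.subst, iht, ihs]
  | _ => rfl

theorem subst_id {Γ : Ctx} {ρ : Ty} (t : Term Γ ρ) : t.subst Subst.id = t := by
  induction t with
  | app t s iht ihs => simp only [Term.subst, iht, ihs]
  | _ => rfl

theorem wk_subst_cons {Γ Δ : Ctx} {ρ τ : Ty} (t : Term Γ τ) (a : Term Δ ρ) (σ : Subst Γ Δ) :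
    t.wk.subst (Subst.cons a σ) = t.subst σ :=
  subst_subst _ _ _

theorem wk_subst_lift {Γ Δ : Ctx} {ρ τ : Ty} (t : Term Γ τ) (σ : Subst Γ Δ) :
    (t.wk (ρ := ρ)).subst σ.lift = (t.subst σ).wk := by
  rw [wk, wk, subst_subst, subst_subst]; rfl

end Term

namespace Subst

theorem lift_id {Γ : Ctx} {ρ : Ty} : (Subst.id (Γ := Γ)).lift (ρ := ρ) = Subst.id := by
  funext τ x; cases x <;> rfl

theorem lift_comp_lift {Γ Δ Θ : Ctx} {ρ : Ty} (σ : Subst Γ Δ) (τ : Subst Δ Θ) :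
    (σ.lift (ρ := ρ)).comp τ.lift = (σ.comp τ).lift := by
  funext _ x
  cases x with
  | here => rfl
  | there x => exact Term.wk_subst_lift _ _

theorem shift_comp_lift {Γ Δ : Ctx} {ρ : Ty} (σ : Subst Γ Δ) :
    (Subst.shift (ρ := ρ)).comp σ.lift = σ.comp Subst.shift := rfl

theorem lift_comp_cons {Γ Δ Θ : Ctx} {ρ : Ty} (σ : Subst Γ Δ) (t : Term Θ ρ) (τ : Subst Δ Θ) :
    (σ.lift (ρ := ρ)).comp (Subst.cons t τ) = Subst.cons t (σ.comp τ) := by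
  funext _ x
  cases x with
  | here => rfl
  | there x => exact Term.wk_subst_cons _ _ _

theorem cons_comp {Γ Δ Θ : Ctx} {ρ : Ty} (t : Term Δ ρ) (σ : Subst Γ Δ) (τ : Subst Δ Θ) :
    (Subst.cons t σ).comp τ = Subst.cons (t.subst τ) (σ.comp τ) := by
  funext _ x
  cases x <;> rfl

theorem comp_id {Γ Δ : Ctx} (σ : Subst Γ Δ) : σ.comp Subst.id = σ := by
  funext _ x; exact Term.subst_id _

theorem id_comp {Γ Δ : Ctx} (σ : Subst Γ Δ) : Subst.id.comp σ = σ := rfl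

end Subst

namespace Formula

theorem subst_subst {Γ Δ Θ : Ctx} (σ : Subst Γ Δ) (τ : Subst Δ Θ) (φ : Formula Γ) :
    (φ.subst σ).subst τ = φ.subst (σ.comp τ) := by
  induction φ generalizing Δ Θ with
  | eq t s => simp only [Formula.subst, Term.subst_subst]
  | falsum => rfl
  | imp φ ψ ihφ ihψ => simp only [Formula.subst, ihφ, ihψ]
  | all ρ φ ih => simp only [Formula.subst, ih, Subst.lift_comp_lift]

theorem subst_id {Γ : Ctx} (φ : Formula Γ) : φ.subst Subst.id = φ := by
  induction φ with
  | eq t s => simp only [Formula.subst, Term.subst_id]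
  | falsum => rfl
  | imp φ ψ ihφ ihψ => simp only [Formula.subst, ihφ, ihψ]
  | all ρ φ ih => simp only [Formula.subst, Subst.lift_id, ih]

theorem inst_subst {Γ Δ : Ctx} {ρ : Ty} (φ : Formula (ρ :: Γ)) (t : Term Γ ρ) (σ : Subst Γ Δ) :
    (φ.inst t).subst σ = (φ.subst σ.lift).inst (t.subst σ) := by
  rw [inst, inst, subst_subst, subst_subst, Subst.lift_comp_cons, Subst.cons_comp,
    Subst.comp_id, Subst.id_comp]

theorem wk_subst_lift {Γ Δ : Ctx} {ρ : Ty} (φ : Formula Γ) (σ : Subst Γ Δ) :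
    (φ.wk (ρ := ρ)).subst σ.lift = (φ.subst σ).wk := by
  rw [wk, wk, subst_subst, subst_subst, Subst.shift_comp_lift]

theorem IsQF.subst {Γ Δ : Ctx} {φ : Formula Γ} (h : φ.IsQF) (σ : Subst Γ Δ) :
    (φ.subst σ).IsQF := by
  induction φ generalizing Δ with
  | eq t s => trivial
  | falsum => trivial
  | imp φ ψ ihφ ihψ => exact ⟨ihφ h.1 σ, ihψ h.2 σ⟩
  | all ρ φ ih => exact h.elim

end Formula

theorem eqAt_subst {Γ Δ : Ctx} {ρ : Ty} (t s : Term Γ ρ) (σ : Subst Γ Δ) :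
    (eqAt ρ t s).subst σ = eqAt ρ (t.subst σ) (s.subst σ) := by
  induction ρ generalizing Γ Δ with
  | nat => rfl
  | arrow ρ τ _ ih =>
    simp only [eqAt, Formula.subst, ih, Term.subst, Term.wk_subst_lift]
    rfl

theorem RCAωAxiom.subst {Γ Δ : Ctx} {φ : Formula Γ} (h : RCAωAxiom Γ φ) (σ : Subst Γ Δ) :
    RCAωAxiom Δ (φ.subst σ) := by
  cases h with
  | succ_ne_zero => exact .succ_ne_zero Δ
  | succ_inj => exact .succ_inj Δ
  | combK ρ τ =>
    simp only [Formula.subst, eqAt_subst]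
    exact .combK Δ ρ τ
  | combS δ ρ τ =>
    simp only [Formula.subst, eqAt_subst]
    exact .combS Δ δ ρ τ
  | rec_zero => exact .rec_zero Δ
  | rec_succ => exact .rec_succ Δ
  | ext ρ τ =>
    simp only [Formula.subst, eqAt_subst]
    exact .ext Δ ρ τ
  | qfInd φ hφ =>
    have := RCAωAxiom.qfInd Δ (φ.subst σ.lift) (hφ.subst _)
    convert this using 1
    simp only [Formula.subst, Formula.inst_subst, Formula.subst_subst, Subst.lift_comp_cons,
      Subst.cons_comp]
    rfl
  | qfAC φ hφ =>
    have := RCAωAxiom.qfAC Δ (φ.subst σ.lift.lift) (hφ.subst _)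
    convert this using 1
    simp only [Formula.subst, Formula.ex, Formula.neg, Formula.subst_subst, Subst.lift_comp_cons,
      Subst.cons_comp]
    congr 8
    funext _ x
    simp only [Subst.comp, Subst.lift, Term.wk, Term.subst_subst, Term.subst, Subst.cons]
    rfl

namespace Derivable

/-- Works because the axiom schemes are themselves closed under substitution. It carries derivations
along the stages of the Henkin construction, and weakening is the case of the identity substitution.
-/
theorem subst {Γ Δ : Ctx} {H : List (Formula Γ)} {φ : Formula Γ}
    (h : Derivable RCAωAxiom H φ) (σ : Subst Γ Δ) {H' : List (Formula Δ)}
    (hH : ∀ ψ ∈ H, ψ.subst σ ∈ H') : Derivable RCAωAxiom H' (φ.subst σ) := by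
  induction h generalizing Δ with
  | ax h => exact .ax (h.subst σ)
  | hyp h => exact .hyp (hH _ h)
  | impI _ ih =>
    refine .impI (ih σ ?_)
    simpa using fun ψ hψ => .inr (hH ψ hψ)
  | impE _ _ ih₁ ih₂ => exact .impE (ih₁ σ hH) (ih₂ σ hH)
  | byContra _ ih =>
    refine .byContra (ih σ ?_)
    simpa [Formula.neg, Formula.subst] using fun ψ hψ => .inr (hH ψ hψ)
  | allI _ ih =>
    refine .allI (ih σ.lift ?_)
    simp only [List.mem_map, forall_exists_index, and_imp, forall_apply_eq_imp_iff₂,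
      Formula.wk_subst_lift]
    exact fun ψ hψ => ⟨_, hH ψ hψ, rfl⟩
  | allE t _ ih =>
    rw [Formula.inst_subst]
    exact .allE _ (ih σ hH)
  | eqRefl t => exact .eqRefl _
  | eqSubst φ _ _ ih₁ ih₂ =>
    have ih₂ := ih₂ σ hH
    rw [Formula.inst_subst] at ih₂ ⊢
    exact .eqSubst _ (ih₁ σ hH) ih₂

theorem mono {Γ : Ctx} {H H' : List (Formula Γ)} {φ : Formula Γ}
    (h : Derivable RCAωAxiom H φ) (hH : H ⊆ H') : Derivable RCAωAxiom H' φ := by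
  have := h.subst Subst.id (H' := H') fun ψ hψ => by rw [Formula.subst_id]; exact hH hψ
  rwa [Formula.subst_id] at this

end Derivable

/-! ### Countability of the syntax -/

/-- A type whose elements all lie in a countable union of sets is countable. -/
theorem countable_of_exhaustion {α : Type} (D : ℕ → Set α) (hD : ∀ n, (D n).Countable)
    (h : ∀ a, ∃ n, a ∈ D n) : Countable α := by
  rw [← Set.countable_univ_iff]
  exact (Set.countable_iUnion hD).mono fun a _ => Set.mem_iUnion.2 (h a)

/-- The types of nesting depth at most `n`. -/
def Ty.ofDepth : ℕ → Set Ty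
  | 0 => {.nat}
  | n + 1 => Ty.ofDepth n ∪ Set.image2 .arrow (Ty.ofDepth n) (Ty.ofDepth n)

theorem Ty.ofDepth_mono : Monotone Ty.ofDepth :=
  monotone_nat_of_le_succ fun _ => Set.subset_union_left

instance Ty.instCountable : Countable Ty := by
  refine countable_of_exhaustion Ty.ofDepth (fun n => ?_) fun ρ => ?_
  · induction n with
    | zero => exact Set.countable_singleton _
    | succ n ih => exact ih.union (ih.image2 ih _)
  · induction ρ with
    | nat => exact ⟨0, rfl⟩
    | arrow ρ τ ihρ ihτ =>
      obtain ⟨m, hm⟩ := ihρ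
      obtain ⟨n, hn⟩ := ihτ
      exact ⟨max m n + 1, .inr ⟨ρ, Ty.ofDepth_mono (le_max_left _ _) hm, τ,
        Ty.ofDepth_mono (le_max_right _ _) hn, rfl⟩⟩

instance Var.instCountable (Γ : Ctx) : Countable (Σ ρ, Var Γ ρ) := by
  induction Γ with
  | nil =>
    have : IsEmpty (Σ ρ, Var [] ρ) := ⟨fun x => nomatch x.2⟩
    infer_instance
  | cons σ Γ ih =>
    refine Function.Surjective.countable (α := Option (Σ ρ, Var Γ ρ))
      (f := fun x => x.elim ⟨σ, .here⟩ fun y => ⟨y.1, .there y.2⟩) ?_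
    rintro ⟨ρ, _ | x⟩
    · exact ⟨none, rfl⟩
    · exact ⟨some ⟨ρ, x⟩, rfl⟩

/-- The terms over `Γ` of nesting depth at most `n`. -/
def Term.ofDepth (Γ : Ctx) : ℕ → Set (Σ ρ, Term Γ ρ)
  | 0 => Set.range (fun x : Σ ρ, Var Γ ρ => ⟨x.1, .var x.2⟩) ∪
      ({⟨_, .zero⟩, ⟨_, .succ⟩, ⟨_, .recN⟩} ∪
      (Set.range (fun p : Ty × Ty => ⟨_, .combK p.1 p.2⟩) ∪
      Set.range (fun p : Ty × Ty × Ty => ⟨_, .combS p.1 p.2.1 p.2.2⟩)))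
  | n + 1 => Term.ofDepth Γ n ∪ ⋃ p : Ty × Ty,
      Set.image2 (fun (t : Term Γ (p.1 ⇒ p.2)) s => ⟨p.2, .app t s⟩)
        (Sigma.mk _ ⁻¹' Term.ofDepth Γ n) (Sigma.mk _ ⁻¹' Term.ofDepth Γ n)

theorem Term.ofDepth_mono (Γ : Ctx) : Monotone (Term.ofDepth Γ) :=
  monotone_nat_of_le_succ fun _ => Set.subset_union_left

instance Term.instCountable (Γ : Ctx) : Countable (Σ ρ, Term Γ ρ) := by
  refine countable_of_exhaustion (Term.ofDepth Γ) (fun n => ?_) ?_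
  · induction n with
    | zero =>
      exact (Set.countable_range _).union ((Set.toFinite _).countable.union
        ((Set.countable_range _).union (Set.countable_range _)))
    | succ n ih =>
      exact ih.union (Set.countable_iUnion fun p =>
        ((ih.preimage sigma_mk_injective).image2 (ih.preimage sigma_mk_injective) _))
  · rintro ⟨ρ, t⟩
    induction t with
    | var x => exact ⟨0, .inl ⟨⟨_, x⟩, rfl⟩⟩
    | zero => exact ⟨0, .inr (.inl (by simp))⟩
    | succ => exact ⟨0, .inr (.inl (by simp))⟩
    | recN => exact ⟨0, .inr (.inl (by simp))⟩
    | combK ρ τ => exact ⟨0, .inr (.inr (.inl ⟨(ρ, τ), rfl⟩))⟩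
    | combS δ ρ τ => exact ⟨0, .inr (.inr (.inr ⟨(δ, ρ, τ), rfl⟩))⟩
    | @app ρ τ t s iht ihs =>
      obtain ⟨m, hm⟩ := iht
      obtain ⟨n, hn⟩ := ihs
      exact ⟨max m n + 1, .inr (Set.mem_iUnion.2 ⟨(ρ, τ), t,
        Term.ofDepth_mono Γ (le_max_left _ _) hm, s,
        Term.ofDepth_mono Γ (le_max_right _ _) hn, rfl⟩)⟩

/-- The formulas over `Γ` of nesting depth at most `n`. -/
def Formula.ofDepth : ℕ → (Γ : Ctx) → Set (Formula Γ)
  | 0, Γ => insert .falsum (Set.image2 .eq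
      (Sigma.mk _ ⁻¹' (Set.univ : Set (Σ ρ, Term Γ ρ)))
      (Sigma.mk _ ⁻¹' (Set.univ : Set (Σ ρ, Term Γ ρ))))
  | n + 1, Γ => Formula.ofDepth n Γ ∪
      (Set.image2 .imp (Formula.ofDepth n Γ) (Formula.ofDepth n Γ) ∪
      ⋃ ρ : Ty, Formula.all ρ '' Formula.ofDepth n (ρ :: Γ))

theorem Formula.ofDepth_mono (Γ : Ctx) : Monotone fun n => Formula.ofDepth n Γ :=
  monotone_nat_of_le_succ fun _ => Set.subset_union_left

instance Formula.instCountable (Γ : Ctx) : Countable (Formula Γ) := by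
  refine countable_of_exhaustion (fun n => Formula.ofDepth n Γ) (fun n => ?_) fun φ => ?_
  · induction n generalizing Γ with
    | zero =>
      refine Set.Countable.insert _ (Set.Countable.image2 ?_ ?_ _) <;>
        exact (Set.to_countable _).preimage sigma_mk_injective
    | succ n ih =>
      exact (ih Γ).union (((ih Γ).image2 (ih Γ) _).union
        (Set.countable_iUnion fun ρ => (ih _).image _))
  · induction φ with
    | eq t s => exact ⟨0, .inr ⟨t, trivial, s, trivial, rfl⟩⟩
    | falsum => exact ⟨0, .inl rfl⟩
    | @imp Γ φ ψ ihφ ihψ =>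
      obtain ⟨m, hm⟩ := ihφ
      obtain ⟨n, hn⟩ := ihψ
      exact ⟨max m n + 1, .inr (.inl ⟨φ, Formula.ofDepth_mono Γ (le_max_left _ _) hm, ψ,
        Formula.ofDepth_mono Γ (le_max_right _ _) hn, rfl⟩)⟩
    | all ρ φ ih =>
      obtain ⟨n, hn⟩ := ih
      exact ⟨n + 1, .inr (.inr (Set.mem_iUnion.2 ⟨ρ, φ, hn, rfl⟩))⟩

/-! ### The Henkin construction -/

open Filter

/-- A list of hypotheses from which falsum is not derivable. -/
def Consistent {Γ : Ctx} (H : List (Formula Γ)) : Prop := ¬ Derivable RCAωAxiom H .falsum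

namespace Derivable

variable {Γ : Ctx} {H : List (Formula Γ)} {φ ψ : Formula Γ}

theorem exFalso (h : Derivable RCAωAxiom H .falsum) : Derivable RCAωAxiom H φ :=
  .byContra (h.mono (List.subset_cons_self _ _))

theorem of_neg_imp_neg (h : Derivable RCAωAxiom H (Formula.imp φ ψ).neg) :
    Derivable RCAωAxiom H φ ∧ Derivable RCAωAxiom H ψ.neg := by
  constructor
  · refine .byContra (.impE (h.mono (List.subset_cons_self _ _)) (.impI (exFalso ?_)))
    exact .impE (.hyp (.tail _ (.head _))) (.hyp (.head _))
  · exact .impI (.impE (h.mono (List.subset_cons_self _ _)) (.impI (.hyp (.tail _ (.head _)))))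

theorem eq_symm {t s : Term Γ .nat} (h : Derivable RCAωAxiom H (.eq t s)) :
    Derivable RCAωAxiom H (.eq s t) := by
  have := Derivable.eqSubst (.eq v0 t.wk) h (by
    simp only [Formula.inst, Formula.subst, Term.wk_subst_cons, Term.subst_id]
    exact .eqRefl t)
  simp only [Formula.inst, Formula.subst, Term.wk_subst_cons, Term.subst_id] at this
  exact this

theorem eq_trans {t s r : Term Γ .nat} (h : Derivable RCAωAxiom H (.eq t s))
    (h' : Derivable RCAωAxiom H (.eq s r)) : Derivable RCAωAxiom H (.eq t r) := by
  have := Derivable.eqSubst (.eq t.wk v0) h' (by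
    simp only [Formula.inst, Formula.subst, Term.wk_subst_cons, Term.subst_id]
    exact h)
  simp only [Formula.inst, Formula.subst, Term.wk_subst_cons, Term.subst_id] at this
  exact this

end Derivable

/-- `H'` decides the image of `φ` under `σ`, with a counterexample if a universal formula is
refuted. -/
def Decides {Γ Δ : Ctx} (σ : Subst Γ Δ) (H' : List (Formula Δ)) (φ : Formula Γ) : Prop :=
  Derivable RCAωAxiom H' (φ.subst σ) ∨ (Derivable RCAωAxiom H' (φ.subst σ).neg ∧
    ∀ (ρ : Ty) (χ : Formula (ρ :: Γ)), φ = .all ρ χ →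
      ∃ t : Term Δ ρ, Derivable RCAωAxiom H' (χ.subst (Subst.cons t σ)).neg)

/-- If `φ` cannot be added consistently, then `H` refutes it. For a refuted universal formula the
context grows by a fresh variable, which serves as the Henkin constant for a counterexample.
Inconsistency of the enlarged list would, by generalization over that variable, derive the universal
formula from `H`. -/
theorem Consistent.exists_decides {Γ : Ctx} {H : List (Formula Γ)} (hH : Consistent H)
    (φ : Formula Γ) : ∃ (Δ : Ctx) (σ : Subst Γ Δ) (H' : List (Formula Δ)),
      Consistent H' ∧ (∀ ψ ∈ H, ψ.subst σ ∈ H') ∧ Decides σ H' φ := by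
  by_cases hφ : Consistent (φ :: H)
  · refine ⟨Γ, Subst.id, φ :: H, hφ, fun ψ hψ => ?_, .inl ?_⟩
    · rw [Formula.subst_id]; exact .tail _ hψ
    · rw [Formula.subst_id]; exact .hyp (.head _)
  have hneg : Derivable RCAωAxiom H φ.neg := .impI (not_not.1 hφ)
  by_cases hall : ∃ (ρ : Ty) (χ : Formula (ρ :: Γ)), φ = .all ρ χ
  · obtain ⟨ρ, χ, rfl⟩ := hall
    refine ⟨ρ :: Γ, Subst.shift, χ.neg :: H.map Formula.wk, fun h => hH ?_, fun ψ hψ => ?_,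
      .inr ⟨?_, ?_⟩⟩
    · exact .impE hneg (.allI (.byContra h))
    · exact .tail _ (List.mem_map_of_mem hψ)
    · exact hneg.subst (Subst.shift (ρ := ρ))
        fun ψ hψ => .tail _ (List.mem_map_of_mem (f := Formula.wk) hψ)
    · rintro _ _ ⟨⟩
      refine ⟨v0, .hyp ?_⟩
      have : Subst.cons v0 (Subst.shift (Γ := Γ) (ρ := ρ)) = Subst.id := by
        funext _ x; cases x <;> rfl
      rw [this, Formula.subst_id]
      exact .head _
  · refine ⟨Γ, Subst.id, H, hH, fun ψ hψ => ?_, .inr ⟨?_, fun ρ χ h => (hall ⟨ρ, χ, h⟩).elim⟩⟩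
    · rwa [Formula.subst_id]
    · rwa [Formula.subst_id]

/-- A stage of the Henkin construction: a consistent list of hypotheses over a context, together
with the formulas that are to be decided. -/
structure Stage where
  /-- The current context. -/
  ctx : Ctx
  /-- The current hypotheses. -/
  hyps : List (Formula ctx)
  /-- The hypotheses are consistent. -/
  consistent : Consistent hyps
  /-- The formula `todo k j` is the `j`th formula over the context of stage `k`. -/
  todo : ℕ → ℕ → Formula ctx

/-- An enumeration of all formulas over `Γ`. -/
noncomputable def Formula.enum (Γ : Ctx) : ℕ → Formula Γ :=
  haveI : Nonempty (Formula Γ) := ⟨.falsum⟩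
  (exists_surjective_nat (Formula Γ)).choose

theorem Formula.enum_surjective (Γ : Ctx) : Function.Surjective (Formula.enum Γ) :=
  haveI : Nonempty (Formula Γ) := ⟨.falsum⟩
  (exists_surjective_nat (Formula Γ)).choose_spec

namespace Stage

/-- Bookkeeping for growing contexts: row `n + 1` is overwritten with all formulas over the new
context, and the other rows are translated. Step `n` reads row `n.unpair.1 ≤ n`, which has already
been filled, and every entry of every row is eventually reached. -/
theorem exists_next (S : Stage) (n : ℕ) : ∃ (S' : Stage) (σ : Subst S.ctx S'.ctx),
    (∀ ψ ∈ S.hyps, ψ.subst σ ∈ S'.hyps) ∧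
    Decides σ S'.hyps (S.todo n.unpair.1 n.unpair.2) ∧
    (∀ k j, k ≠ n + 1 → S'.todo k j = (S.todo k j).subst σ) ∧
    S'.todo (n + 1) = Formula.enum S'.ctx := by
  obtain ⟨Δ, σ, H', hH', hsub, hdec⟩ := S.consistent.exists_decides (S.todo n.unpair.1 n.unpair.2)
  refine ⟨⟨Δ, H', hH', fun k => if k = n + 1 then Formula.enum Δ else
    fun j => (S.todo k j).subst σ⟩, σ, hsub, hdec, fun k j hk => ?_, ?_⟩
  · simp [hk]
  · simp

/-- The Henkin construction from a stage `S`. -/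
noncomputable def chain (S : Stage) : ℕ → Stage
  | 0 => S
  | n + 1 => ((chain S n).exists_next n).choose

variable (S : Stage)

/-- The translation from each stage to the next. -/
noncomputable def trans (n : ℕ) : Subst (S.chain n).ctx (S.chain (n + 1)).ctx :=
  ((S.chain n).exists_next n).choose_spec.choose

theorem chain_spec (n : ℕ) :
    (∀ ψ ∈ (S.chain n).hyps, ψ.subst (S.trans n) ∈ (S.chain (n + 1)).hyps) ∧
    Decides (S.trans n) (S.chain (n + 1)).hyps
      ((S.chain n).todo n.unpair.1 n.unpair.2) ∧
    (∀ k j, k ≠ n + 1 →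
      (S.chain (n + 1)).todo k j = ((S.chain n).todo k j).subst (S.trans n)) ∧
    (S.chain (n + 1)).todo (n + 1) = Formula.enum (S.chain (n + 1)).ctx :=
  ((S.chain n).exists_next n).choose_spec.choose_spec

/-- Derivability at stage `n`. -/
def Prov (n : ℕ) (φ : Formula (S.chain n).ctx) : Prop :=
  Derivable RCAωAxiom (S.chain n).hyps φ

theorem Prov.succ {n : ℕ} {φ : Formula (S.chain n).ctx} (h : S.Prov n φ) :
    S.Prov (n + 1) (φ.subst (S.trans n)) :=
  Derivable.subst h _ (S.chain_spec n).1

/-- A family of formulas, one for each stage, which is eventually translated into itself. -/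
def Coherent (φ : ∀ n, Formula (S.chain n).ctx) : Prop :=
  ∀ᶠ n in atTop, φ (n + 1) = (φ n).subst (S.trans n)

theorem Coherent.eventually_of_prov {φ : ∀ n, Formula (S.chain n).ctx} {n : ℕ}
    (hφ : ∀ m ≥ n, φ (m + 1) = (φ m).subst (S.trans m)) (h : S.Prov n (φ n)) :
    ∀ᶠ m in atTop, S.Prov m (φ m) := by
  filter_upwards [eventually_ge_atTop n] with m hm
  induction m, hm using Nat.le_induction with
  | base => exact h
  | succ m hm ih => rw [hφ m hm]; exact ih.succ

/-- At stage `N` the formula is entry `j` of row `N`; both are then translated in the same way, so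
they still agree at step `Nat.pair N j ≥ N`, where that entry is treated. -/
theorem exists_todo_eq (hS : S.todo 0 = Formula.enum S.ctx) {φ : ∀ n, Formula (S.chain n).ctx}
    {N : ℕ} (hN : ∀ m ≥ N, φ (m + 1) = (φ m).subst (S.trans m)) :
    ∃ n ≥ N, φ n = (S.chain n).todo n.unpair.1 n.unpair.2 := by
  have henum : (S.chain N).todo N = Formula.enum (S.chain N).ctx := by
    cases N with
    | zero => exact hS
    | succ n => exact (S.chain_spec n).2.2.2
  obtain ⟨j, hj⟩ := Formula.enum_surjective _ (φ N)
  have key : ∀ m ≥ N, φ m = (S.chain m).todo N j := by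
    intro m hm
    induction m, hm using Nat.le_induction with
    | base => rw [henum, hj]
    | succ m hm ih => rw [hN m hm, (S.chain_spec m).2.2.1 N j (by omega), ih]
  refine ⟨Nat.pair N j, Nat.left_le_pair N j, ?_⟩
  rw [key _ (Nat.left_le_pair N j), Nat.unpair_pair]

theorem Coherent.decided (hS : S.todo 0 = Formula.enum S.ctx) {φ : ∀ n, Formula (S.chain n).ctx}
    (hφ : S.Coherent φ) :
    (∀ᶠ n in atTop, S.Prov n (φ n)) ∨ (∀ᶠ n in atTop, S.Prov n (φ n).neg) := by
  obtain ⟨N, hN⟩ := eventually_atTop.1 hφ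
  obtain ⟨n, hNn, htodo⟩ := S.exists_todo_eq hS hN
  replace hN := fun m hm => hN m (hNn.trans hm)
  have hdec := (S.chain_spec n).2.1
  rw [← htodo] at hdec
  rcases hdec with h | ⟨h, -⟩
  · rw [← hN n le_rfl] at h
    exact .inl (Coherent.eventually_of_prov S (n := n + 1) (fun m hm => hN m (by omega)) h)
  · rw [← hN n le_rfl] at h
    refine .inr (Coherent.eventually_of_prov S (φ := fun n => (φ n).neg) (n := n + 1)
      (fun m hm => ?_) h)
    show (φ (m + 1)).neg = _
    rw [hN m (by omega)]; rfl

theorem not_eventually_prov_falsum : ¬ ∀ᶠ n in atTop, S.Prov n .falsum := fun h => by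
  obtain ⟨n, hn⟩ := h.exists
  exact (S.chain n).consistent hn

/-- The elements of the term model: families of terms, one for each stage, that are eventually
translated into each other. -/
def Elem (ρ : Ty) : Type :=
  {t : ∀ n, Term (S.chain n).ctx ρ // ∀ᶠ n in atTop, t (n + 1) = (t n).subst (S.trans n)}

end Stage

/-- A closed term of each type. -/
def Ty.default : (ρ : Ty) → {Γ : Ctx} → Term Γ ρ
  | .nat, _ => .zero
  | .arrow ρ τ, _ => .combK τ ρ ⬝ τ.default

theorem Stage.exists_elem (S : Stage) {ρ : Ty} (n : ℕ) (t : Term (S.chain n).ctx ρ) :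
    ∃ a : S.Elem ρ, a.1 n = t ∧ ∀ m ≥ n, a.1 (m + 1) = (a.1 m).subst (S.trans m) := by
  -- The values before stage `n` are irrelevant and are filled with a closed term.
  let f (m : ℕ) : Term (S.chain m).ctx ρ := if h : n ≤ m then
    Nat.leRec (motive := fun m _ => Term (S.chain m).ctx ρ) t
      (fun k _ a => a.subst (S.trans k)) h else ρ.default
  have hf : ∀ m ≥ n, f (m + 1) = (f m).subst (S.trans m) := by
    intro m hm
    simp only [f, dif_pos hm, dif_pos (Nat.le_succ_of_le hm)]
    exact Nat.leRec_succ _ _ _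
  refine ⟨⟨f, eventually_atTop.2 ⟨n, hf⟩⟩, ?_, hf⟩
  simp only [f, dif_pos le_rfl, Nat.leRec_self]

/-! ### Applicative structures, satisfaction, and the extensional quotient -/

open Filter

/-- A typed applicative structure for the language. -/
structure Struct where
  /-- The elements of each type. -/
  carrier : Ty → Type
  /-- Application. -/
  app {ρ τ : Ty} : carrier (ρ ⇒ τ) → carrier ρ → carrier τ
  /-- The constant `0`. -/
  zero : carrier .nat
  /-- The constant `S`. -/
  succ : carrier .one
  /-- The combinators `Π`. -/
  combK (ρ τ : Ty) : carrier (ρ ⇒ τ ⇒ ρ)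
  /-- The combinators `Σ`. -/
  combS (δ ρ τ : Ty) : carrier ((δ ⇒ ρ ⇒ τ) ⇒ (δ ⇒ ρ) ⇒ δ ⇒ τ)
  /-- The recursor. -/
  recN : carrier (.nat ⇒ .nat ⇒ (.nat ⇒ .nat ⇒ .nat) ⇒ .nat)

namespace Struct

variable (A : Struct)

/-- An assignment of elements to the variables of a context. -/
abbrev Env (Γ : Ctx) : Type := ∀ ρ : Ty, Var Γ ρ → A.carrier ρ

/-- The empty assignment. -/
def Env.nil : A.Env [] := fun _ x => nomatch x

variable {A}

/-- Extend an assignment by a value for the newest variable. -/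
def Env.cons {Γ : Ctx} {ρ : Ty} (a : A.carrier ρ) (e : A.Env Γ) : A.Env (ρ :: Γ)
  | _, .here => a
  | _, .there x => e _ x

/-- The value of a term. -/
def eval {Γ : Ctx} (e : A.Env Γ) : {ρ : Ty} → Term Γ ρ → A.carrier ρ
  | _, .var x => e _ x
  | _, .zero => A.zero
  | _, .succ => A.succ
  | _, .combK ρ τ => A.combK ρ τ
  | _, .combS δ ρ τ => A.combS δ ρ τ
  | _, .recN => A.recN
  | _, .app t s => A.app (eval e t) (eval e s)

theorem eval_subst {Γ Δ : Ctx} (e : A.Env Δ) (σ : Subst Γ Δ) {ρ : Ty} (t : Term Γ ρ) :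
    eval e (t.subst σ) = eval (fun _ x => eval e (σ _ x)) t := by
  induction t with
  | app t s iht ihs => simp only [Term.subst, eval, iht, ihs]
  | _ => rfl

theorem eval_wk {Γ : Ctx} {ρ τ : Ty} (a : A.carrier ρ) (e : A.Env Γ) (t : Term Γ τ) :
    eval (Env.cons a e) t.wk = eval e t :=
  eval_subst _ _ _

/-- Satisfaction, where `E` interprets equality of numbers. -/
def Sat (E : A.carrier .nat → A.carrier .nat → Prop) :
    {Γ : Ctx} → A.Env Γ → Formula Γ → Prop
  | _, e, .eq t s => E (eval e t) (eval e s)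
  | _, _, .falsum => False
  | _, e, .imp φ ψ => Sat E e φ → Sat E e ψ
  | _, e, .all ρ φ => ∀ a : A.carrier ρ, Sat E (Env.cons a e) φ

/-- Pointwise equality over `E`. -/
def EqAt (E : A.carrier .nat → A.carrier .nat → Prop) :
    (ρ : Ty) → A.carrier ρ → A.carrier ρ → Prop
  | .nat, a, b => E a b
  | .arrow _ τ, f, g => ∀ a, EqAt E τ (A.app f a) (A.app g a)

variable {E : A.carrier .nat → A.carrier .nat → Prop} {Γ : Ctx} (e : A.Env Γ)

theorem sat_eqAt {ρ : Ty} (t s : Term Γ ρ) :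
    Sat E e (eqAt ρ t s) ↔ EqAt E ρ (eval e t) (eval e s) := by
  induction ρ generalizing Γ with
  | nat => rfl
  | arrow ρ τ _ ih =>
    refine forall_congr' fun a => ?_
    rw [ih]
    simp only [eval, eval_wk, Env.cons]

theorem sat_neg {φ : Formula Γ} : Sat E e φ.neg ↔ ¬ Sat E e φ := Iff.rfl

theorem sat_or {φ ψ : Formula Γ} : Sat E e (φ.or ψ) ↔ Sat E e φ ∨ Sat E e ψ :=
  or_iff_not_imp_left.symm

theorem sat_and {φ ψ : Formula Γ} : Sat E e (φ.and ψ) ↔ Sat E e φ ∧ Sat E e ψ :=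
  Classical.not_imp.trans (and_congr_right' not_not)

theorem sat_iff {φ ψ : Formula Γ} : Sat E e (φ.iff ψ) ↔ (Sat E e φ ↔ Sat E e ψ) :=
  (sat_and e).trans iff_def.symm

theorem sat_ex {ρ : Ty} {φ : Formula (ρ :: Γ)} :
    Sat E e (φ.ex ρ) ↔ ∃ a, Sat E (Env.cons a e) φ :=
  not_forall_not

theorem eqAt_equivalence (hE : Equivalence E) (ρ : Ty) : Equivalence (EqAt E ρ) := by
  induction ρ with
  | nat => exact hE
  | arrow ρ τ _ ih =>
    exact ⟨fun f a => ih.refl _, fun h a => ih.symm (h a), fun h h' a => ih.trans (h a) (h' a)⟩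

section Quotient

variable (hE : Equivalence E)
  (hext : ∀ (ρ τ : Ty) (f : A.carrier (ρ ⇒ τ)) (a b : A.carrier ρ),
    EqAt E ρ a b → EqAt E τ (A.app f a) (A.app f b))

/-- The setoid of pointwise equality. -/
def eqSetoid (hE : Equivalence E) (ρ : Ty) : Setoid (A.carrier ρ) :=
  ⟨EqAt E ρ, eqAt_equivalence hE ρ⟩

/-- The class of an element. -/
def toQuot (ρ : Ty) (a : A.carrier ρ) : Quotient (eqSetoid hE ρ) := Quotient.mk _ a

/-- The quotient by pointwise equality. -/
def quot : Struct where
  carrier ρ := Quotient (eqSetoid hE ρ)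
  app := Quotient.map₂ A.app fun f _ hf _ b hab =>
    (eqAt_equivalence hE _).trans (hext _ _ f _ _ hab) (hf b)
  zero := toQuot hE _ A.zero
  succ := toQuot hE _ A.succ
  combK ρ τ := toQuot hE _ (A.combK ρ τ)
  combS δ ρ τ := toQuot hE _ (A.combS δ ρ τ)
  recN := toQuot hE _ A.recN

/-- The classes of the values of an assignment. -/
def Env.toQuot {Γ : Ctx} (e : A.Env Γ) : (quot hE hext).Env Γ :=
  fun ρ x => Struct.toQuot hE ρ (e ρ x)

theorem eval_quot {ρ : Ty} (t : Term Γ ρ) :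
    eval (e.toQuot hE hext) t = toQuot hE ρ (eval e t) := by
  induction t with
  | app t s iht ihs => simp only [eval, iht, ihs]; rfl
  | _ => rfl

theorem Env.toQuot_cons {ρ : Ty} (a : A.carrier ρ) :
    (Env.cons a e).toQuot hE hext = Env.cons (A := quot hE hext) (Struct.toQuot hE ρ a)
      (e.toQuot hE hext) := by
  funext _ x
  cases x <;> rfl

/-- Passing to classes makes the interpretation of equality at type `0` genuine without changing
truth. The hypothesis `hext`, that application respects pointwise equality, is what makes
application well defined on classes. -/
theorem sat_quot (φ : Formula Γ) : Sat Eq (e.toQuot hE hext) φ ↔ Sat E e φ := by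
  induction φ with
  | eq t s =>
    simp only [Sat, eval_quot]
    exact Quotient.eq (r := eqSetoid hE .nat)
  | falsum => rfl
  | imp φ ψ ihφ ihψ => exact imp_congr (ihφ e) (ihψ e)
  | all ρ φ ih =>
    have h (a : A.carrier ρ) : Sat Eq (Env.cons (A := quot hE hext) (toQuot hE ρ a)
        (e.toQuot hE hext)) φ ↔ Sat E (Env.cons a e) φ := by
      rw [← Env.toQuot_cons, ih]
    exact ⟨fun H a => (h a).1 (H _), fun H => Quotient.ind fun a => (h a).2 (H a)⟩

theorem quot_ext {ρ τ : Ty} (f g : (quot hE hext).carrier (ρ ⇒ τ))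
    (h : ∀ a, (quot hE hext).app f a = (quot hE hext).app g a) : f = g := by
  induction f, g using Quotient.inductionOn₂ with
  | _ f g => exact Quotient.sound fun a => Quotient.exact (h (toQuot hE ρ a))

end Quotient

theorem eqAt_eq_iff (hext : ∀ (ρ τ : Ty) (f g : A.carrier (ρ ⇒ τ)),
    (∀ a, A.app f a = A.app g a) → f = g) {ρ : Ty} (a b : A.carrier ρ) :
    EqAt Eq ρ a b ↔ a = b := by
  induction ρ with
  | nat => rfl
  | arrow ρ τ _ ih =>
    exact ⟨fun h => hext _ _ _ _ fun x => (ih _ _).1 (h x), fun h x => h ▸ (ih _ _).2 rfl⟩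

end Struct

/-- An extensional model of `RCA₀^ω`. -/
structure Model extends Struct where
  /-- Equality is pointwise. -/
  ext {ρ τ : Ty} {f g : carrier (ρ ⇒ τ)} : (∀ a, app f a = app g a) → f = g
  /-- The axioms hold. -/
  sat_of_ax {Γ : Ctx} {φ : Formula Γ} : RCAωAxiom Γ φ →
    ∀ e : toStruct.Env Γ, Struct.Sat Eq e φ

/-! ### The term model and completeness -/

namespace Stage

variable (S : Stage)

/-- The term model of the Henkin construction. -/
def termStruct : Struct where
  carrier := S.Elem
  app f a := ⟨fun n => f.1 n ⬝ a.1 n, by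
    filter_upwards [f.2, a.2] with n hf ha
    rw [hf, ha]; rfl⟩
  zero := ⟨fun _ => .zero, .of_forall fun _ => rfl⟩
  succ := ⟨fun _ => .succ, .of_forall fun _ => rfl⟩
  combK ρ τ := ⟨fun _ => .combK ρ τ, .of_forall fun _ => rfl⟩
  combS δ ρ τ := ⟨fun _ => .combS δ ρ τ, .of_forall fun _ => rfl⟩
  recN := ⟨fun _ => .recN, .of_forall fun _ => rfl⟩

/-- Eventually derivable equality of numbers. -/
def termEq (a b : S.termStruct.carrier .nat) : Prop :=
  ∀ᶠ n in atTop, S.Prov n (.eq ((show S.Elem .nat from a).1 n) ((show S.Elem .nat from b).1 n))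

/-- The substitution of the values of an assignment at stage `n`. -/
def envSubst {Γ : Ctx} (e : S.termStruct.Env Γ) (n : ℕ) : Subst Γ (S.chain n).ctx :=
  fun ρ x => (show S.Elem ρ from e ρ x).1 n

theorem termEq_equivalence : Equivalence S.termEq where
  refl _ := .of_forall fun _ => .eqRefl _
  symm h := h.mono fun _ => Derivable.eq_symm
  trans h h' := (h.and h').mono fun _ h => h.1.eq_trans h.2

theorem eval_termStruct {Γ : Ctx} (e : S.termStruct.Env Γ) {ρ : Ty} (t : Term Γ ρ) (n : ℕ) :
    (Struct.eval e t).1 n = t.subst (S.envSubst e n) := by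
  induction t with
  | app t s iht ihs => simp only [Term.subst, ← iht, ← ihs]; rfl
  | _ => rfl

theorem envSubst_cons {Γ : Ctx} {ρ : Ty} (a : S.termStruct.carrier ρ) (e : S.termStruct.Env Γ)
    (n : ℕ) : S.envSubst (Struct.Env.cons a e) n =
      Subst.cons ((show S.Elem ρ from a).1 n) (S.envSubst e n) := by
  funext _ x
  cases x <;> rfl

/-- A context is a finite list, so finitely many eventual conditions combine into one. -/
theorem eventually_envSubst_succ {Γ : Ctx} (e : S.termStruct.Env Γ) :
    ∀ᶠ n in atTop, S.envSubst e (n + 1) = (S.envSubst e n).comp (S.trans n) := by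
  induction Γ with
  | nil => exact .of_forall fun n => funext fun _ => funext fun x => nomatch x
  | cons ρ Γ ih =>
    filter_upwards [ih fun τ x => e τ (.there x), (e ρ .here).2] with n hn h₀
    funext τ x
    cases x with
    | here => exact h₀
    | there x => exact congr_fun (congr_fun hn τ) x

theorem coherent_subst {Γ : Ctx} (e : S.termStruct.Env Γ) (φ : Formula Γ) :
    S.Coherent fun n => φ.subst (S.envSubst e n) := by
  filter_upwards [S.eventually_envSubst_succ e] with n hn
  rw [hn, Formula.subst_subst]

theorem exists_counterexample (hS : S.todo 0 = Formula.enum S.ctx) {Γ : Ctx} {ρ : Ty}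
    (e : S.termStruct.Env Γ) (χ : Formula (ρ :: Γ))
    (h : ∀ᶠ n in atTop, S.Prov n (Formula.all ρ χ |>.subst (S.envSubst e n)).neg) :
    ∃ a : S.Elem ρ,
      ∀ᶠ n in atTop, S.Prov n (χ.subst (Subst.cons (a.1 n) (S.envSubst e n))).neg := by
  obtain ⟨N, hN⟩ := eventually_atTop.1 (S.eventually_envSubst_succ e)
  have hcoh : ∀ m ≥ N, (Formula.all ρ χ).subst (S.envSubst e (m + 1)) =
      ((Formula.all ρ χ).subst (S.envSubst e m)).subst (S.trans m) := fun m hm => by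
    rw [hN m hm, Formula.subst_subst]
  obtain ⟨n, hNn, htodo⟩ := S.exists_todo_eq hS
    (φ := fun n => (Formula.all ρ χ).subst (S.envSubst e n)) hcoh
  have hdec := (S.chain_spec n).2.1
  rw [← htodo] at hdec
  rcases hdec with h' | ⟨-, h'⟩
  -- A derivation of the universal formula would persist to a stage at which its negation is
  -- derivable too.
  · rw [← hcoh n hNn] at h'
    obtain ⟨m, hm⟩ := ((Coherent.eventually_of_prov S (n := n + 1)
      (φ := fun n => (Formula.all ρ χ).subst (S.envSubst e n))
      (fun m hm => hcoh m (by omega)) h').and h).exists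
    exact ((S.chain m).consistent (.impE hm.2 hm.1)).elim
  · obtain ⟨t, ht⟩ := h' ρ _ rfl
    obtain ⟨a, rfl, ha⟩ := S.exists_elem _ t
    refine ⟨a, Coherent.eventually_of_prov S (n := n + 1)
      (φ := fun n => (χ.subst (Subst.cons (a.1 n) (S.envSubst e n))).neg) (fun m hm => ?_) ?_⟩
    · show Formula.neg _ = Formula.neg _
      rw [hN m (by omega), ha m hm, Formula.subst_subst, Subst.cons_comp]
    · rw [Formula.subst_subst, Subst.lift_comp_cons, ← hN n hNn] at ht
      exact ht

/-- Truth in the term model is eventual derivability. The implication and quantifier cases use that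
each formula is eventually decided, together with the Henkin counterexample for a refuted universal
formula. -/
theorem truth (hS : S.todo 0 = Formula.enum S.ctx) {Γ : Ctx} (e : S.termStruct.Env Γ)
    (φ : Formula Γ) :
    Struct.Sat S.termEq e φ ↔ ∀ᶠ n in atTop, S.Prov n (φ.subst (S.envSubst e n)) := by
  have excl {ψ : ∀ n, Formula (S.chain n).ctx} (h : ∀ᶠ n in atTop, S.Prov n (ψ n))
      (h' : ∀ᶠ n in atTop, S.Prov n (ψ n).neg) : False :=
    S.not_eventually_prov_falsum ((h.and h').mono fun _ h => .impE h.2 h.1)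
  induction φ with
  | eq t s =>
    simp only [Struct.Sat, termEq, eval_termStruct]
    rfl
  | falsum => exact (iff_of_false id S.not_eventually_prov_falsum)
  | imp φ ψ ihφ ihψ =>
    simp only [Struct.Sat, ihφ, ihψ]
    constructor
    · intro h
      rcases Coherent.decided S hS (S.coherent_subst e (φ.imp ψ)) with h' | h'
      · exact h'
      · have h₁ := h'.mono fun _ h => h.of_neg_imp_neg.1
        have h₂ := h'.mono fun _ h => h.of_neg_imp_neg.2
        exact (excl (h h₁) h₂).elim
    · exact fun h h' => (h.and h').mono fun _ h => .impE h.1 h.2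
  | all ρ φ ih =>
    simp only [Struct.Sat, ih]
    constructor
    · intro h
      rcases Coherent.decided S hS (S.coherent_subst e (φ.all ρ)) with h' | h'
      · exact h'
      · obtain ⟨a, ha⟩ := S.exists_counterexample hS e φ h'
        exact (excl (h a) (ha.mono fun n hn =>
          (congrArg (fun σ => S.Prov n (φ.subst σ).neg) (S.envSubst_cons a e n)).mpr hn)).elim
    · intro h a
      refine h.mono fun n hn => ?_
      have := Derivable.allE (a.1 n) hn
      rw [Formula.inst, Formula.subst_subst, Subst.lift_comp_cons, Subst.comp_id] at this
      rw [envSubst_cons]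
      exact this

theorem exists_model {φ : Formula []} (h : ¬ RCAωProves φ) :
    ∃ M : Model, ¬ Struct.Sat Eq (Struct.Env.nil M.toStruct) φ := by
  -- Only row `0` of the initial list matters; the later rows are overwritten before they are read.
  let S : Stage := ⟨[], [φ.neg], fun h' => h (.byContra h'), fun _ => Formula.enum []⟩
  have hE := S.termEq_equivalence
  have hax {Γ : Ctx} {ψ : Formula Γ} (hψ : RCAωAxiom Γ ψ) (e : S.termStruct.Env Γ) :
      Struct.Sat S.termEq e ψ := (S.truth rfl _ _).2 (.of_forall fun n => .ax (hψ.subst _))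
  have hext (ρ τ : Ty) (f : S.termStruct.carrier (ρ ⇒ τ)) (a b : S.termStruct.carrier ρ)
      (hab : Struct.EqAt S.termEq ρ a b) :
      Struct.EqAt S.termEq τ (S.termStruct.app f a) (S.termStruct.app f b) := by
    have := hax (.ext [] ρ τ) (Struct.Env.nil _) f a b
    exact (Struct.sat_eqAt _ _ _).1 (this ((Struct.sat_eqAt _ _ _).2 hab))
  have hnil : (Struct.Env.nil S.termStruct).toQuot hE hext = Struct.Env.nil _ :=
    funext fun _ => funext fun x => nomatch x
  refine ⟨⟨Struct.quot hE hext, fun h => Struct.quot_ext hE hext _ _ h, fun hψ e => ?_⟩, ?_⟩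
  -- Every assignment into the quotient comes from chosen representatives, so the axioms transfer
  -- from the term model.
  · have he : Struct.Env.toQuot hE hext (fun ρ x => Quotient.out (e ρ x)) = e :=
      funext fun ρ => funext fun x => Quotient.out_eq _
    rw [← he]
    exact (Struct.sat_quot _ hE hext _).2 (hax hψ _)
  · show ¬ Struct.Sat (A := Struct.quot hE hext) Eq (Struct.Env.nil _) φ
    rw [← hnil]
    refine mt (Struct.sat_quot _ hE hext _).1 ?_
    show Struct.Sat S.termEq _ φ.neg
    refine (S.truth rfl _ _).2 ?_
    have h0 : φ.neg.subst (S.envSubst (Struct.Env.nil _) 0) = φ.neg := by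
      have : S.envSubst (Struct.Env.nil _) 0 = Subst.id (Γ := []) :=
        funext fun _ => funext fun x => nomatch x
      rw [this]
      exact Formula.subst_id _
    refine Coherent.eventually_of_prov S (φ := fun n => φ.neg.subst _) (n := 0) (fun m _ => ?_) ?_
    · rw [Formula.subst_subst]
      congr 1
      funext _ x
      exact nomatch x
    · rw [h0]
      exact .hyp (.head _)

end Stage

/-- Completeness: a sentence that holds in all extensional models is derivable. -/
theorem RCAωProves.of_forall_model {φ : Formula []}
    (h : ∀ M : Model, Struct.Sat Eq (Struct.Env.nil M.toStruct) φ) : RCAωProves φ := by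
  by_contra hφ
  obtain ⟨M, hM⟩ := Stage.exists_model hφ
  exact hM (h M)

/-! ### Combinatory abstraction and arithmetic in a model -/

open Struct

/-- Application. -/
notation:75 f:75 " ⊙ " a:76 => Struct.app _ f a

/-- Abstraction of the newest variable. -/
def Term.lam {Γ : Ctx} {ρ : Ty} : {τ : Ty} → Term (ρ :: Γ) τ → Term Γ (ρ ⇒ τ)
  | _, .var .here => .combS ρ (ρ ⇒ ρ) ρ ⬝ .combK ρ (ρ ⇒ ρ) ⬝ .combK ρ ρ
  | _, .var (.there x) => .combK _ ρ ⬝ .var x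
  | _, .zero => .combK _ ρ ⬝ .zero
  | _, .succ => .combK _ ρ ⬝ .succ
  | _, .combK σ τ => .combK _ ρ ⬝ .combK σ τ
  | _, .combS δ σ τ => .combK _ ρ ⬝ .combS δ σ τ
  | _, .recN => .combK _ ρ ⬝ .recN
  | _, .app t s => .combS ρ _ _ ⬝ t.lam ⬝ s.lam

theorem Struct.sat_subst {A : Struct} {E : A.carrier .nat → A.carrier .nat → Prop} {Γ Δ : Ctx}
    (e : A.Env Δ) (σ : Subst Γ Δ) (φ : Formula Γ) :
    Sat E e (φ.subst σ) ↔ Sat E (fun _ x => eval e (σ _ x)) φ := by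
  induction φ generalizing Δ with
  | eq t s => simp only [Formula.subst, Sat, eval_subst]
  | falsum => rfl
  | imp φ ψ ihφ ihψ => exact imp_congr (ihφ e σ) (ihψ e σ)
  | all ρ φ ih =>
    refine forall_congr' fun a => (ih _ _).trans (iff_of_eq (congrArg (fun e => Sat E e φ) ?_))
    funext _ x
    cases x with
    | here => rfl
    | there x => exact eval_wk _ _ _

namespace Model

variable {M : Model}

theorem sat_eqAt_iff {Γ : Ctx} (e : M.Env Γ) {ρ : Ty} (t s : Term Γ ρ) :
    Sat Eq e (eqAt ρ t s) ↔ eval e t = eval e s :=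
  (sat_eqAt e t s).trans (eqAt_eq_iff (fun _ _ _ _ => M.ext) _ _)

@[simp]
theorem combK_app {ρ τ : Ty} (a : M.carrier ρ) (b : M.carrier τ) : M.combK ρ τ ⊙ a ⊙ b = a :=
  (sat_eqAt_iff _ _ _).1 (M.sat_of_ax (.combK [] ρ τ) (Env.nil _) a b)

@[simp]
theorem combS_app {δ ρ τ : Ty} (f : M.carrier (δ ⇒ ρ ⇒ τ)) (g : M.carrier (δ ⇒ ρ))
    (a : M.carrier δ) : M.combS δ ρ τ ⊙ f ⊙ g ⊙ a = f ⊙ a ⊙ (g ⊙ a) :=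
  (sat_eqAt_iff _ _ _).1 (M.sat_of_ax (.combS [] δ ρ τ) (Env.nil _) f g a)

@[simp]
theorem recN_zero (a : M.carrier .nat) (f : M.carrier (.nat ⇒ .nat ⇒ .nat)) :
    M.recN ⊙ M.zero ⊙ a ⊙ f = a :=
  M.sat_of_ax (.rec_zero []) (Env.nil _) a f

@[simp]
theorem recN_succ (n a : M.carrier .nat) (f : M.carrier (.nat ⇒ .nat ⇒ .nat)) :
    M.recN ⊙ (M.succ ⊙ n) ⊙ a ⊙ f = f ⊙ (M.recN ⊙ n ⊙ a ⊙ f) ⊙ n :=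
  M.sat_of_ax (.rec_succ []) (Env.nil _) n a f

@[simp]
theorem succ_ne_zero (n : M.carrier .nat) : M.succ ⊙ n ≠ M.zero :=
  M.sat_of_ax (.succ_ne_zero []) (Env.nil _) n

@[simp]
theorem succ_inj {n m : M.carrier .nat} : M.succ ⊙ n = M.succ ⊙ m ↔ n = m :=
  ⟨M.sat_of_ax (.succ_inj []) (Env.nil _) n m, fun h => h ▸ rfl⟩

@[simp]
theorem eval_lam {Γ : Ctx} {ρ τ : Ty} (t : Term (ρ :: Γ) τ) (e : M.Env Γ) (a : M.carrier ρ) :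
    eval e t.lam ⊙ a = eval (Env.cons a e) t :=
  match t with
  | .var .here => by simp [Term.lam, eval, Env.cons]
  | .var (.there x) => by simp [Term.lam, eval, Env.cons]
  | .app t s => by simp only [Term.lam, eval, combS_app, eval_lam t, eval_lam s]
  | .zero | .succ | .recN | .combK .. | .combS .. => by simp [Term.lam, eval]

theorem qf_induction {Γ : Ctx} (e : M.Env Γ) (φ : Formula (.nat :: Γ)) (hφ : φ.IsQF)
    (h₀ : Sat Eq (Env.cons M.zero e) φ)
    (hs : ∀ n, Sat Eq (Env.cons n e) φ → Sat Eq (Env.cons (M.succ ⊙ n) e) φ) (n : M.carrier .nat) :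
    Sat Eq (Env.cons n e) φ := by
  refine M.sat_of_ax (.qfInd Γ φ hφ) e ((sat_subst _ _ _).2 ?_) (fun n h =>
    (sat_subst _ _ _).2 ?_) n
  · convert h₀ using 1
    funext _ x
    cases x <;> rfl
  · convert hs n h using 1
    funext _ x
    cases x <;> rfl

theorem qf_choice (F : M.carrier (.one ⇒ .nat ⇒ .nat)) (h : ∀ f, ∃ n, F ⊙ f ⊙ n = M.zero) :
    ∃ Y : M.carrier .two, ∀ f, F ⊙ f ⊙ (Y ⊙ f) = M.zero := by
  have := M.sat_of_ax (.qfAC [.one ⇒ .nat ⇒ .nat] (.eq (v2 ⬝ v1 ⬝ v0) .zero) trivial)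
    (Env.cons F (Env.nil _)) fun f => (sat_ex _).2 (h f)
  exact (sat_ex _).1 this

/-- Predecessor. -/
def pred (n : M.carrier .nat) : M.carrier .nat := eval (Env.nil _) predT ⊙ n

@[simp]
theorem pred_zero : pred M.zero = M.zero := by simp [pred, predT, eval]

@[simp]
theorem pred_succ (n : M.carrier .nat) : pred (M.succ ⊙ n) = n := by
  simp [pred, predT, eval, sndT, idT]

/-- Truncated subtraction. -/
def sub (a b : M.carrier .nat) : M.carrier .nat :=
  M.recN ⊙ b ⊙ a ⊙ eval (Env.nil _) (.combS .nat .nat (.nat ⇒ .nat)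
      ⬝ (.combK (.nat ⇒ .nat ⇒ .nat) .nat ⬝ .combK .nat .nat) ⬝ predT)

@[simp]
theorem eval_subT {Γ : Ctx} (e : M.Env Γ) (t s : Term Γ .nat) :
    eval e (subT t s) = sub (eval e t) (eval e s) := rfl

@[simp]
theorem sub_zero (a : M.carrier .nat) : sub a M.zero = a := by simp [sub]

theorem sub_succ (a b : M.carrier .nat) : sub a (M.succ ⊙ b) = pred (sub a b) := by
  simp [sub, eval, pred]

theorem eq_zero_or_eq_succ (n : M.carrier .nat) : n = M.zero ∨ ∃ m, n = M.succ ⊙ m := by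
  have h : ∀ n : M.carrier .nat, n ≠ M.zero → n = M.succ ⊙ pred n :=
    qf_induction (Env.nil _) (.imp (Formula.eq v0 .zero).neg (.eq v0 (.succ ⬝ (predT ⬝ v0))))
      ⟨⟨trivial, trivial⟩, trivial⟩ (fun h => (h rfl).elim)
      (fun n _ _ => by
        show M.succ ⊙ n = M.succ ⊙ pred (M.succ ⊙ n)
        rw [pred_succ])
  exact or_iff_not_imp_left.2 fun hn => ⟨_, h n hn⟩

theorem induction_eq {f g : M.carrier .one} (h₀ : f ⊙ M.zero = g ⊙ M.zero)
    (hs : ∀ n, f ⊙ n = g ⊙ n → f ⊙ (M.succ ⊙ n) = g ⊙ (M.succ ⊙ n)) (n : M.carrier .nat) :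
    f ⊙ n = g ⊙ n :=
  qf_induction (Env.cons f (Env.cons g (Env.nil _))) (.eq (v1 ⬝ v0) (v2 ⬝ v0)) trivial h₀ hs n

/-- The function `f` is given by an element of the model. -/
def Rep {τ : Ty} (f : M.carrier .nat → M.carrier τ) : Prop :=
  ∃ F : M.carrier (.nat ⇒ τ), ∀ n, F ⊙ n = f n

theorem Rep.const {τ : Ty} (c : M.carrier τ) : Rep fun _ : M.carrier .nat => c :=
  ⟨M.combK _ _ ⊙ c, by simp⟩

theorem Rep.id : Rep fun n : M.carrier .nat => n :=
  ⟨M.combS .nat (.nat ⇒ .nat) .nat ⊙ M.combK .nat (.nat ⇒ .nat) ⊙ M.combK .nat .nat, by simp⟩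

theorem Rep.app {ρ τ : Ty} {f : M.carrier .nat → M.carrier (ρ ⇒ τ)}
    {g : M.carrier .nat → M.carrier ρ} (hf : Rep f) (hg : Rep g) : Rep fun n => f n ⊙ g n := by
  obtain ⟨F, hF⟩ := hf
  obtain ⟨G, hG⟩ := hg
  exact ⟨M.combS _ _ _ ⊙ F ⊙ G, by simp [hF, hG]⟩

theorem Rep.sub {f g : M.carrier .nat → M.carrier .nat} (hf : Rep f) (hg : Rep g) :
    Rep fun n => sub (f n) (g n) :=
  ((Rep.app (.const _) hg).app hf).app (.const _)

/-- Quantifier-free induction in a model applies only to functions that the model represents. Hence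
each use below carries a proof of representability. -/
theorem Rep.induction_eq {f g : M.carrier .nat → M.carrier .nat} (hf : Rep f) (hg : Rep g)
    (h₀ : f M.zero = g M.zero)
    (hs : ∀ n, f n = g n → f (M.succ ⊙ n) = g (M.succ ⊙ n)) (n : M.carrier .nat) : f n = g n := by
  obtain ⟨F, hF⟩ := hf
  obtain ⟨G, hG⟩ := hg
  simp only [← hF, ← hG] at *
  exact Model.induction_eq h₀ hs n

@[simp]
theorem succ_sub_succ (a b : M.carrier .nat) :
    Model.sub (M.succ ⊙ a) (M.succ ⊙ b) = Model.sub a b := by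
  refine Rep.induction_eq (f := fun b => Model.sub (M.succ ⊙ a) (M.succ ⊙ b))
    (g := fun b => Model.sub a b)
    (.sub (.const _) (.app (.const _) .id)) (.sub (.const _) .id) (by simp [sub_succ]) (fun n h => ?_) b
  show Model.sub _ _ = Model.sub _ _
  rw [sub_succ, h, sub_succ]

@[simp]
theorem zero_sub (a : M.carrier .nat) : Model.sub M.zero a = M.zero :=
  Rep.induction_eq (f := fun a => Model.sub M.zero a) (g := fun _ => M.zero)
    (.sub (.const _) .id) (.const _) (by simp) (fun n h => by simp [sub_succ, h]) a

@[simp]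
theorem sub_self (a : M.carrier .nat) : Model.sub a a = M.zero :=
  Rep.induction_eq (f := fun a => Model.sub a a) (g := fun _ => M.zero)
    (.sub .id .id) (.const _) (by simp) (fun n h => by simp [h]) a

/-- Induction on `a` with `b` universally quantified is not quantifier-free. Instead, a
counterexample `a`, `b` is kept fixed and `k` is subtracted from both: by induction on `k` it
remains a counterexample, which is absurd at `k = a`. -/
theorem eq_of_sub_eq_zero {a b : M.carrier .nat} (hab : Model.sub a b = M.zero)
    (hba : Model.sub b a = M.zero) : a = b := by
  by_contra hne
  have key : ∀ k, ¬ (Model.sub (Model.sub a k) (Model.sub b k) = M.zero →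
      Model.sub (Model.sub b k) (Model.sub a k) = M.zero → Model.sub a k = Model.sub b k) := by
    refine qf_induction (Env.cons a (Env.cons b (Env.nil _)))
      (Formula.neg (.imp (.eq (subT (subT v1 v0) (subT v2 v0)) .zero)
        (.imp (.eq (subT (subT v2 v0) (subT v1 v0)) .zero) (.eq (subT v1 v0) (subT v2 v0)))))
      ⟨⟨trivial, trivial, trivial⟩, trivial⟩ ?_ ?_
    · show ¬ (Model.sub (Model.sub a M.zero) (Model.sub b M.zero) = M.zero →
        Model.sub (Model.sub b M.zero) (Model.sub a M.zero) = M.zero →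
          Model.sub a M.zero = Model.sub b M.zero)
      simp [hab, hba, hne]
    · intro k
      show ¬ (Model.sub (Model.sub a k) (Model.sub b k) = M.zero →
        Model.sub (Model.sub b k) (Model.sub a k) = M.zero → Model.sub a k = Model.sub b k) →
        ¬ (Model.sub (Model.sub a (M.succ ⊙ k)) (Model.sub b (M.succ ⊙ k)) = M.zero →
        Model.sub (Model.sub b (M.succ ⊙ k)) (Model.sub a (M.succ ⊙ k)) = M.zero →
          Model.sub a (M.succ ⊙ k) = Model.sub b (M.succ ⊙ k))
      rw [sub_succ, sub_succ]
      rcases eq_zero_or_eq_succ (Model.sub a k) with h | ⟨x, h⟩ <;>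
        rcases eq_zero_or_eq_succ (Model.sub b k) with h' | ⟨y, h'⟩ <;> simp [h, h']
  refine key a fun _ h => ?_
  rw [sub_self, sub_zero] at h
  rw [sub_self, h]

/-- Definition by cases: `b` if `a = 0`, otherwise `c`. -/
def cond (a b c : M.carrier .nat) : M.carrier .nat :=
  M.recN ⊙ a ⊙ b ⊙ (M.combK _ _ ⊙ (M.combK _ _ ⊙ c))

@[simp]
theorem cond_zero (b c : M.carrier .nat) : cond M.zero b c = b := by simp [cond]

@[simp]
theorem cond_succ (a b c : M.carrier .nat) : cond (M.succ ⊙ a) b c = c := by simp [cond]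

open Classical in
theorem cond_eq_ite (a b c : M.carrier .nat) : cond a b c = if a = M.zero then b else c := by
  rcases eq_zero_or_eq_succ a with rfl | ⟨a, rfl⟩ <;> simp

/-- The numeral `1`. -/
def one : M.carrier .nat := M.succ ⊙ M.zero

@[simp]
theorem one_ne_zero : (one : M.carrier .nat) ≠ M.zero := succ_ne_zero _

theorem Rep.cond {f g h : M.carrier .nat → M.carrier .nat} (hf : Rep f) (hg : Rep g)
    (hh : Rep h) : Rep fun n => cond (f n) (g n) (h n) :=
  ((Rep.app (.const _) hf).app hg).app (.app (.const _) (.app (.const _) hh))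

/-- The predicate `p` is given by the zeros of an element of the model. -/
def Dec (p : M.carrier .nat → Prop) : Prop := ∃ f, Rep f ∧ ∀ n, p n ↔ f n = M.zero

theorem Dec.not {p : M.carrier .nat → Prop} (hp : Dec p) : Dec fun n => ¬ p n := by
  obtain ⟨f, hf, hpf⟩ := hp
  refine ⟨_, hf.cond (.const one) (.const M.zero), fun n => ?_⟩
  simp only [hpf, cond_eq_ite]
  split_ifs with h <;> simp [h]

theorem Dec.and {p q : M.carrier .nat → Prop} (hp : Dec p) (hq : Dec q) :
    Dec fun n => p n ∧ q n := by
  obtain ⟨f, hf, hpf⟩ := hp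
  obtain ⟨g, hg, hqg⟩ := hq
  refine ⟨_, hf.cond hg (.const one), fun n => ?_⟩
  simp only [hpf, hqg, cond_eq_ite]
  split_ifs with h <;> simp [h]

theorem Dec.congr {p q : M.carrier .nat → Prop} (hp : Dec p) (h : ∀ n, q n ↔ p n) : Dec q :=
  let ⟨f, hf, hpf⟩ := hp
  ⟨f, hf, fun n => (h n).trans (hpf n)⟩

theorem Dec.imp {p q : M.carrier .nat → Prop} (hp : Dec p) (hq : Dec q) :
    Dec fun n => p n → q n :=
  (hp.and hq.not).not.congr fun n => by tauto

theorem Dec.or {p q : M.carrier .nat → Prop} (hp : Dec p) (hq : Dec q) :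
    Dec fun n => p n ∨ q n :=
  (hp.not.imp hq).congr fun n => by tauto

theorem cond_sub_eq_zero_iff (a b : M.carrier .nat) :
    Model.cond (Model.sub a b) (Model.sub b a) one = M.zero ↔ a = b := by
  rw [cond_eq_ite]
  split_ifs with h
  · exact ⟨eq_of_sub_eq_zero h, fun h' => by rw [h', sub_self]⟩
  · exact iff_of_false one_ne_zero fun h' => h (by rw [h', sub_self])

theorem Dec.eq {f g : M.carrier .nat → M.carrier .nat} (hf : Rep f) (hg : Rep g) :
    Dec fun n => f n = g n :=
  ⟨_, (hf.sub hg).cond (hg.sub hf) (.const one), fun _ => (cond_sub_eq_zero_iff _ _).symm⟩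

theorem Dec.induction {p : M.carrier .nat → Prop} (hp : Dec p) (h₀ : p M.zero)
    (hs : ∀ n, p n → p (M.succ ⊙ n)) (n : M.carrier .nat) : p n := by
  obtain ⟨f, ⟨F, hF⟩, hpf⟩ := hp
  simp only [hpf, ← hF] at *
  exact qf_induction (Env.cons F (Env.nil _)) (.eq (v1 ⬝ v0) .zero) trivial h₀ hs n

end Model

/-! ### The linear order on numbers and the meaning of the principles in a model -/

namespace Model

variable {M : Model}

/-- The descent of `eq_of_sub_eq_zero`: a failure survives subtracting `k` from both numbers, and `k
= a` gives a contradiction. The next two lemmas are proved in the same way. -/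
theorem sub_total (a b : M.carrier .nat) : sub a b = M.zero ∨ sub b a = M.zero := by
  by_contra hab
  have key := Dec.induction (p := fun k => ¬ (sub (sub a k) (sub b k) = M.zero ∨
      sub (sub b k) (sub a k) = M.zero))
    (.not (.or (.eq (.sub (.sub (.const _) .id) (.sub (.const _) .id)) (.const _))
      (.eq (.sub (.sub (.const _) .id) (.sub (.const _) .id)) (.const _))))
    (by simpa using hab) (fun k => by
      rw [sub_succ, sub_succ]
      rcases eq_zero_or_eq_succ (sub a k) with h | ⟨x, h⟩ <;>
        rcases eq_zero_or_eq_succ (sub b k) with h' | ⟨y, h'⟩ <;> simp [h, h'])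
  exact key a (by simp)

theorem sub_trans {a b c : M.carrier .nat} (hab : sub a b = M.zero) (hbc : sub b c = M.zero) :
    sub a c = M.zero := by
  by_contra hac
  have key := Dec.induction (p := fun k => sub (sub a k) (sub b k) = M.zero ∧
      sub (sub b k) (sub c k) = M.zero ∧ ¬ sub (sub a k) (sub c k) = M.zero)
    (.and (.eq (.sub (.sub (.const _) .id) (.sub (.const _) .id)) (.const _))
      (.and (.eq (.sub (.sub (.const _) .id) (.sub (.const _) .id)) (.const _))
      (.not (.eq (.sub (.sub (.const _) .id) (.sub (.const _) .id)) (.const _)))))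
    (by simpa using ⟨hab, hbc, hac⟩) (fun k => by
      rw [sub_succ, sub_succ, sub_succ]
      rcases eq_zero_or_eq_succ (sub a k) with h | ⟨x, h⟩ <;>
        rcases eq_zero_or_eq_succ (sub b k) with h' | ⟨y, h'⟩ <;>
        rcases eq_zero_or_eq_succ (sub c k) with h'' | ⟨z, h''⟩ <;> simp +contextual [h, h', h''])
  exact (key a).2.2 (by simp)

theorem sub_succ_eq_zero {a b : M.carrier .nat} (hba : sub b a ≠ M.zero) :
    sub (M.succ ⊙ a) b = M.zero := by
  by_contra hab
  have key := Dec.induction (p := fun k => ¬ sub (sub b k) (sub a k) = M.zero ∧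
      ¬ sub (M.succ ⊙ sub a k) (sub b k) = M.zero)
    (.and (.not (.eq (.sub (.sub (.const _) .id) (.sub (.const _) .id)) (.const _)))
      (.not (.eq (.sub (.app (.const _) (.sub (.const _) .id)) (.sub (.const _) .id)) (.const _))))
    (by simpa using ⟨hba, hab⟩) (fun k => by
      rw [sub_succ, sub_succ]
      rcases eq_zero_or_eq_succ (sub a k) with h | ⟨x, h⟩ <;>
        rcases eq_zero_or_eq_succ (sub b k) with h' | ⟨y, h'⟩ <;> simp +contextual [h, h'])
  obtain ⟨h₁, h₂⟩ := key a
  rw [sub_self] at h₁ h₂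
  rcases eq_zero_or_eq_succ (sub b a) with h | ⟨x, h⟩ <;> simp [h] at h₁ h₂

theorem succ_sub_self (a : M.carrier .nat) : sub (M.succ ⊙ a) a = one :=
  Rep.induction_eq (f := fun a => sub (M.succ ⊙ a) a) (g := fun _ => one)
    (.sub (.app (.const _) .id) .id) (.const _) (by simp [one]) (fun n h => by simpa using h) a

noncomputable instance instLinearOrder : LinearOrder (M.carrier .nat) where
  le a b := sub a b = M.zero
  le_refl := sub_self
  le_trans _ _ _ := sub_trans
  le_antisymm _ _ := eq_of_sub_eq_zero
  le_total := sub_total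
  toDecidableLE := Classical.decRel _

theorem le_iff_sub {a b : M.carrier .nat} : a ≤ b ↔ sub a b = M.zero := Iff.rfl

theorem succ_le_iff {a b : M.carrier .nat} : M.succ ⊙ a ≤ b ↔ a < b := by
  rw [← not_le, le_iff_sub, le_iff_sub]
  refine ⟨fun h h' => ?_, sub_succ_eq_zero⟩
  have := sub_trans h h'
  rw [succ_sub_self] at this
  exact one_ne_zero this

@[simp]
theorem zero_le' (a : M.carrier .nat) : M.zero ≤ a := zero_sub a

@[simp]
theorem lt_succ_self (a : M.carrier .nat) : a < M.succ ⊙ a := succ_le_iff.1 le_rfl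

theorem succ_le_succ_iff {a b : M.carrier .nat} : M.succ ⊙ a ≤ M.succ ⊙ b ↔ a ≤ b := by
  rw [le_iff_sub, le_iff_sub, succ_sub_succ]

theorem lt_succ_iff {a b : M.carrier .nat} : a < M.succ ⊙ b ↔ a ≤ b := by
  rw [← succ_le_iff, succ_le_succ_iff]

theorem le_succ_iff {a b : M.carrier .nat} : a ≤ M.succ ⊙ b ↔ a ≤ b ∨ a = M.succ ⊙ b := by
  rw [le_iff_lt_or_eq, lt_succ_iff]

@[simp]
theorem le_zero_iff {a : M.carrier .nat} : a ≤ M.zero ↔ a = M.zero := by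
  rw [le_iff_sub, sub_zero]

theorem Dec.le {f g : M.carrier .nat → M.carrier .nat} (hf : Rep f) (hg : Rep g) :
    Dec fun n => f n ≤ g n :=
  .eq (hf.sub hg) (.const _)

theorem Dec.lt {f g : M.carrier .nat → M.carrier .nat} (hf : Rep f) (hg : Rep g) :
    Dec fun n => f n < g n :=
  (Dec.le hg hf).not.congr fun _ => not_le.symm

section Formulas

variable {Γ : Ctx} (e : M.Env Γ)

theorem sat_le {s t : Term Γ .nat} : Sat Eq e (le s t) ↔ eval e s ≤ eval e t := Iff.rfl

theorem sat_lt {s t : Term Γ .nat} : Sat Eq e (lt s t) ↔ eval e s < eval e t := succ_le_iff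

theorem sat_mem {n : Term Γ .nat} {X : Term Γ .one} :
    Sat Eq e (mem n X) ↔ eval e X ⊙ eval e n = one := Iff.rfl

/-- The function `X` is binary. -/
def IsSet (X : M.carrier .one) : Prop := ∀ n, X ⊙ n = M.zero ∨ X ⊙ n = one

/-- The infinite set `C` is cohesive for `R` with bounds `b`. -/
def IsCohesive (R : M.carrier .seq) (C b : M.carrier .one) : Prop :=
  IsSet C ∧ (∀ k, ∃ l, k < l ∧ C ⊙ l = one) ∧ ∀ i,
    (∀ n, C ⊙ n = one → b ⊙ i ≤ n → R ⊙ i ⊙ n = one) ∨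
    (∀ n, C ⊙ n = one → b ⊙ i ≤ n → ¬ R ⊙ i ⊙ n = one)

/-- The functionals `Φ₁` and `Φ₂` satisfy `UCOH`. -/
def IsUCOH (Φ₁ Φ₂ : M.carrier (.seq ⇒ .one)) : Prop :=
  ∀ R : M.carrier .seq, (∀ i, IsSet (R ⊙ i)) → IsCohesive R (Φ₁ ⊙ R) (Φ₂ ⊙ R)

/-- The functional `μ` satisfies `MU`. -/
def IsMu (μ : M.carrier .two) : Prop :=
  ∀ f : M.carrier .one, (∃ n, f ⊙ n = M.zero) → f ⊙ (μ ⊙ f) = M.zero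

/-- The functional `Ξ` witnesses that the values of `Φ₁` are infinite. -/
def IsInfWitness (Φ₁ Ξ : M.carrier (.seq ⇒ .one)) : Prop :=
  ∀ R : M.carrier .seq, (∀ i, IsSet (R ⊙ i)) →
    ∀ k, k < Ξ ⊙ R ⊙ k ∧ Φ₁ ⊙ R ⊙ (Ξ ⊙ R ⊙ k) = one

theorem sat_UCOHFor {Φ₁ Φ₂ : Term Γ (.seq ⇒ .one)} :
    Sat Eq e (UCOHFor Φ₁ Φ₂) ↔ IsUCOH (eval e Φ₁) (eval e Φ₂) := by
  simp only [UCOHFor, isSetSeq, isCohesive, isSet, isInfinite, Sat, sat_or, sat_and, sat_ex,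
    sat_lt, sat_le, sat_mem, sat_neg, eval, eval_wk, Env.cons]
  rfl

theorem sat_MUFor {μ : Term Γ .two} : Sat Eq e (MUFor μ) ↔ IsMu (eval e μ) := by
  simp only [MUFor, Sat, sat_ex, eval, eval_wk, Env.cons]
  rfl

theorem sat_InfWitness {Φ₁ Ξ : Term Γ (.seq ⇒ .one)} :
    Sat Eq e (InfWitness Φ₁ Ξ) ↔ IsInfWitness (eval e Φ₁) (eval e Ξ) := by
  simp only [InfWitness, isSetSeq, isSet, Sat, sat_or, sat_and, sat_lt, sat_mem, eval, eval_wk,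
    Env.cons]
  rfl

end Formulas

end Model

/-! ### Terms for truth values; numerical quantifiers by means of `μ` -/

section Terms

variable {Γ : Ctx}

/-- Definition by cases: `b` if `a = 0`, otherwise `c`. -/
def condT (a b c : Term Γ .nat) : Term Γ .nat :=
  .recN ⬝ a ⬝ b ⬝ (.combK _ _ ⬝ (.combK _ _ ⬝ c))

/-- Negation of truth values, where `0` is true. -/
def notT (a : Term Γ .nat) : Term Γ .nat := condT a oneT .zero

/-- Conjunction of truth values. -/
def andT (a b : Term Γ .nat) : Term Γ .nat := condT a b oneT

/-- The truth value of `a = b`. -/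
def eqT (a b : Term Γ .nat) : Term Γ .nat := condT (subT a b) (subT b a) oneT

/-- The truth value of `a < b`. -/
def ltT (a b : Term Γ .nat) : Term Γ .nat := subT (.succ ⬝ a) b

/-- The truth value of `∃ n, t n = 0`, by means of `μ`. -/
def exT (μ : Term Γ .two) (t : Term (.nat :: Γ) .nat) : Term Γ .nat := t.lam ⬝ (μ ⬝ t.lam)

end Terms

namespace Model

variable {M : Model} {Γ : Ctx} (e : M.Env Γ)

@[simp]
theorem eval_condT (a b c : Term Γ .nat) :
    eval e (condT a b c) = cond (eval e a) (eval e b) (eval e c) := rfl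

@[simp]
theorem eval_oneT : eval e oneT = (one : M.carrier .nat) := rfl

theorem eval_notT {a : Term Γ .nat} : eval e (notT a) = M.zero ↔ ¬ eval e a = M.zero := by
  simp only [notT, eval_condT, cond_eq_ite]
  split_ifs with h <;> simp [h, eval]

theorem eval_andT {a b : Term Γ .nat} :
    eval e (andT a b) = M.zero ↔ eval e a = M.zero ∧ eval e b = M.zero := by
  simp only [andT, eval_condT, cond_eq_ite]
  split_ifs with h <;> simp [h]

theorem eval_eqT {a b : Term Γ .nat} : eval e (eqT a b) = M.zero ↔ eval e a = eval e b :=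
  cond_sub_eq_zero_iff _ _

theorem eval_ltT {a b : Term Γ .nat} : eval e (ltT a b) = M.zero ↔ eval e a < eval e b :=
  succ_le_iff

theorem eval_exT {μ : Term Γ .two} (hμ : IsMu (eval e μ)) {t : Term (.nat :: Γ) .nat} :
    eval e (exT μ t) = M.zero ↔ ∃ n, eval (Env.cons n e) t = M.zero := by
  simp only [← eval_lam]
  exact ⟨fun h => ⟨_, h⟩, hμ (eval e t.lam)⟩

theorem Rep.eval {τ : Ty} (t : Term (.nat :: Γ) τ) : Rep fun n => eval (Env.cons n e) t :=
  ⟨Struct.eval e t.lam, eval_lam t e⟩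

end Model

/-! ### From `UCOH` with an infinitude witness to `μ` -/

section Terms

variable {Γ : Ctx}

/-- Bounded search: the least zero of `f` below `n`, or `n` if there is none. -/
def searchT (f : Term Γ .one) (n : Term Γ .nat) : Term Γ .nat :=
  .recN ⬝ n ⬝ .zero ⬝ Term.lam (Term.lam (condT (f.wk.wk ⬝ v1) v1 (.succ ⬝ v0)))

/-- The set of all upper bounds of zeros of `f`, as a constant sequence. -/
def tailSeqT (f : Term Γ .one) : Term Γ .seq :=
  .combK _ _ ⬝ Term.lam (condT (f.wk ⬝ searchT f.wk v0) oneT .zero)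

/-- The functional `μ` obtained from `UCOH` and a witness for infinitude. -/
def muT : Term Γ ((Ty.seq ⇒ Ty.one) ⇒ (Ty.seq ⇒ Ty.one) ⇒ (Ty.seq ⇒ Ty.one) ⇒ Ty.two) :=
  .lam (.lam (.lam (.lam
    (searchT v0 (v1 ⬝ tailSeqT v0 ⬝ (v2 ⬝ tailSeqT v0 ⬝ .zero))))))

end Terms

namespace Model

variable {M : Model} {Γ : Ctx}

/-- Bounded search: the least zero of `f` below `n`, or `n` if there is none. -/
def search (f : M.carrier .one) (n : M.carrier .nat) : M.carrier .nat :=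
  M.recN ⊙ n ⊙ M.zero ⊙
    eval (Env.cons f (Env.nil _)) (Term.lam (Term.lam (condT (v2 ⬝ v1) v1 (.succ ⬝ v0))))

@[simp]
theorem eval_searchT (e : M.Env Γ) (f : Term Γ .one) (n : Term Γ .nat) :
    eval e (searchT f n) = search (eval e f) (eval e n) := by
  simp only [searchT, search, eval]
  congr 1
  refine M.ext fun a => M.ext fun n => ?_
  simp [eval, eval_wk, Env.cons]

theorem search_zero (f : M.carrier .one) : search f M.zero = M.zero := by
  simp [search]

theorem search_succ (f : M.carrier .one) (n : M.carrier .nat) :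
    search f (M.succ ⊙ n) = cond (f ⊙ search f n) (search f n) (M.succ ⊙ n) := by
  simp [search, eval, Env.cons]

theorem Rep.search (f : M.carrier .one) : Rep (search f) :=
  .app (.app (.app (.const _) .id) (.const _)) (.const _)

theorem search_eq_self_or (f : M.carrier .one) (n : M.carrier .nat) :
    f ⊙ search f n = M.zero ∨ search f n = n := by
  refine Dec.induction (p := fun n => f ⊙ search f n = M.zero ∨ search f n = n)
    (.or (.eq (.app (.const _) (.search f)) (.const _)) (.eq (.search f) .id))
    (.inr (search_zero f)) (fun n _ => ?_) n
  rw [search_succ, cond_eq_ite]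
  split_ifs with h
  · exact .inl h
  · exact .inr rfl

/-- Once the search has met a zero it stays there; otherwise its value is the current bound, which
is itself a zero when the bound reaches `n`. -/
theorem search_spec {f : M.carrier .one} {n m : M.carrier .nat} (hn : f ⊙ n = M.zero)
    (hm : n ≤ m) : f ⊙ search f m = M.zero := by
  refine Dec.induction (p := fun m => n ≤ m → f ⊙ search f m = M.zero)
    (.imp (.le (.const _) .id) (.eq (.app (.const _) (.search f)) (.const _)))
    (fun h => ?_) (fun m ih h => ?_) m hm
  · obtain rfl := le_zero_iff.1 h
    rw [search_zero, hn]
  · rcases le_succ_iff.1 h with h | h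
    · rw [search_succ, ih h, cond_zero, ih h]
    · rcases search_eq_self_or f (M.succ ⊙ m) with h' | h'
      · exact h'
      · rw [h', ← h, hn]

/-- The set of all upper bounds of zeros of `f`, as a constant sequence. -/
def tailSeq (f : M.carrier .one) : M.carrier .seq := eval (Env.cons f (Env.nil _)) (tailSeqT v0)

open Classical in
theorem tailSeq_app (f : M.carrier .one) (i n : M.carrier .nat) :
    tailSeq f ⊙ i ⊙ n = if f ⊙ search f n = M.zero then one else M.zero := by
  simp [tailSeq, tailSeqT, eval, eval_wk, Env.cons, cond_eq_ite]

@[simp]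
theorem eval_tailSeqT (e : M.Env Γ) (f : Term Γ .one) :
    eval e (tailSeqT f) = tailSeq (eval e f) := by
  refine M.ext fun i => M.ext fun n => ?_
  simp [tailSeq, tailSeqT, eval, eval_wk, Env.cons]

theorem eval_muT (e : M.Env Γ) (Φ₁ Φ₂ Ξ : M.carrier (.seq ⇒ .one)) (f : M.carrier .one) :
    eval e muT ⊙ Φ₁ ⊙ Φ₂ ⊙ Ξ ⊙ f =
      search f (Ξ ⊙ tailSeq f ⊙ (Φ₂ ⊙ tailSeq f ⊙ M.zero)) := by
  simp [muT, eval, Env.cons]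

/-- `Ξ` gives an element of the cohesive set beyond its bound. If the cohesive set is eventually
inside the tail set, this element bounds a zero of `f`, and the search below it succeeds. The other
alternative contradicts infinitude. -/
theorem isMu_of_isUCOH (e : M.Env Γ) {Φ₁ Φ₂ Ξ : M.carrier (.seq ⇒ .one)} (hΦ : IsUCOH Φ₁ Φ₂)
    (hΞ : IsInfWitness Φ₁ Ξ) : IsMu (eval e muT ⊙ Φ₁ ⊙ Φ₂ ⊙ Ξ) := by
  rintro f ⟨n, hn⟩
  rw [eval_muT]
  have hset (i : M.carrier .nat) : IsSet (tailSeq f ⊙ i) := fun n => by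
    rw [tailSeq_app]; split_ifs <;> simp
  obtain ⟨hl, hlC⟩ := hΞ (tailSeq f) hset (Φ₂ ⊙ tailSeq f ⊙ M.zero)
  obtain ⟨-, hinf, hcoh⟩ := hΦ (tailSeq f) hset
  rcases hcoh M.zero with h | h
  · have := h _ hlC hl.le
    rw [tailSeq_app] at this
    by_contra hne
    rw [if_neg hne] at this
    exact one_ne_zero this.symm
  -- An element beyond both the bound and the given zero `n` lies in the tail set.
  · obtain ⟨l, hlt, hlC⟩ := hinf (max n (Φ₂ ⊙ tailSeq f ⊙ M.zero))
    refine (h l hlC ((le_max_right _ _).trans hlt.le) ?_).elim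
    rw [tailSeq_app, if_pos (search_spec hn ((le_max_left _ _).trans hlt.le))]

end Model

/-! ### Witnesses for infinitude from quantifier-free choice -/

section Terms

variable {Γ : Ctx}

/-- Addition. -/
def addT (a b : Term Γ .nat) : Term Γ .nat := .recN ⬝ a ⬝ b ⬝ Term.lam (Term.lam (.succ ⬝ v1))

/-- Triangular numbers. -/
def triT (n : Term Γ .nat) : Term Γ .nat :=
  .recN ⬝ n ⬝ .zero ⬝ Term.lam (Term.lam (addT v1 (.succ ⬝ v0)))

/-- The index of the diagonal on which the `n`th pair lies. -/
def diagT (n : Term Γ .nat) : Term Γ .nat :=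
  .recN ⬝ n ⬝ .zero ⬝ Term.lam (Term.lam
    (condT (subT (triT (.succ ⬝ v1)) (.succ ⬝ v0)) (.succ ⬝ v1) v1))

/-- Cantor pairing. -/
def pairT (a b : Term Γ .nat) : Term Γ .nat := addT (triT (addT a b)) a

/-- The first component of a pair. -/
def fstT (n : Term Γ .nat) : Term Γ .nat := subT n (triT (diagT n))

/-- The second component of a pair. -/
def sndPairT (n : Term Γ .nat) : Term Γ .nat := subT (diagT n) (fstT n)

/-- The code of a sequence together with a number. -/
def codeT (R : Term Γ .seq) (k : Term Γ .nat) : Term Γ .one :=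
  Term.lam (condT v0 k.wk (R.wk ⬝ fstT (predT ⬝ v0) ⬝ sndPairT (predT ⬝ v0)))

/-- The sequence of sets coded by `f`. -/
def decodeT (f : Term Γ .one) : Term Γ .seq :=
  Term.lam (Term.lam (condT (f.wk.wk ⬝ (.succ ⬝ pairT v1 v0)) .zero oneT))

end Terms

namespace Model

variable {M : Model} {Γ : Ctx} (e : M.Env Γ)

/-- Addition. -/
def add (a b : M.carrier .nat) : M.carrier .nat :=
  M.recN ⊙ a ⊙ b ⊙ eval (Env.nil _) (Term.lam (Term.lam (.succ ⬝ v1)))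

@[simp]
theorem eval_addT (a b : Term Γ .nat) : eval e (addT a b) = add (eval e a) (eval e b) := by
  simp only [addT, add, eval]
  congr 1

@[simp]
theorem zero_add (b : M.carrier .nat) : add M.zero b = b := by simp [add]

@[simp]
theorem succ_add (a b : M.carrier .nat) : add (M.succ ⊙ a) b = M.succ ⊙ add a b := by
  simp [add, eval, Env.cons]

theorem Rep.add {f g : M.carrier .nat → M.carrier .nat} (hf : Rep f) (hg : Rep g) :
    Rep fun n => add (f n) (g n) :=
  .app (.app (.app (.const _) hf) hg) (.const _)

theorem add_sub_cancel_left (a b : M.carrier .nat) : sub (add a b) a = b :=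
  Rep.induction_eq (f := fun a => sub (Model.add a b) a) (g := fun _ => b)
    (.sub (.add .id (.const _)) .id) (.const _) (by simp) (fun n h => by simpa using h) a

theorem le_add_right (a b : M.carrier .nat) : a ≤ add a b :=
  Dec.induction (p := fun a => a ≤ Model.add a b) (.le .id (.add .id (.const _))) (by simp)
    (fun n h => by rw [succ_add, succ_le_succ_iff]; exact h) a

theorem add_lt_add_left {b c : M.carrier .nat} (h : b < c) (a : M.carrier .nat) :
    add a b < add a c :=
  Dec.induction (p := fun a => Model.add a b < Model.add a c)
    (.lt (.add .id (.const _)) (.add .id (.const _))) (by simpa using h)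
    (fun n h => by rwa [succ_add, succ_add, ← succ_le_iff, succ_le_succ_iff, succ_le_iff]) a

/-- Triangular numbers. -/
def tri (n : M.carrier .nat) : M.carrier .nat :=
  M.recN ⊙ n ⊙ M.zero ⊙ eval (Env.nil _) (Term.lam (Term.lam (addT v1 (.succ ⬝ v0))))

@[simp]
theorem eval_triT (n : Term Γ .nat) : eval e (triT n) = tri (eval e n) := by
  simp only [triT, tri, eval]
  congr 1

theorem tri_zero : tri (M.zero : M.carrier .nat) = M.zero := by simp [tri]

theorem tri_succ (n : M.carrier .nat) : tri (M.succ ⊙ n) = add (tri n) (M.succ ⊙ n) := by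
  simp [tri, eval, Env.cons]

theorem Rep.tri {f : M.carrier .nat → M.carrier .nat} (hf : Rep f) : Rep fun n => tri (f n) :=
  .app (.app (.app (.const _) hf) (.const _)) (.const _)

theorem tri_lt_tri_succ (n : M.carrier .nat) : tri n < tri (M.succ ⊙ n) := by
  rw [tri_succ]
  exact (le_add_right _ M.zero).trans_lt
    (add_lt_add_left ((zero_le' n).trans_lt (lt_succ_self n)) _)

theorem tri_mono {n m : M.carrier .nat} (h : n ≤ m) : tri n ≤ tri m := by
  refine Dec.induction (p := fun m => n ≤ m → tri n ≤ tri m)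
    (.imp (.le (.const _) .id) (.le (.const _) (.tri .id))) (fun h => ?_) (fun m ih h => ?_) m h
  · rw [le_zero_iff.1 h]
  · rcases le_succ_iff.1 h with h | rfl
    · exact (ih h).trans (tri_lt_tri_succ m).le
    · exact le_rfl

/-- The index of the diagonal on which the `n`th pair lies. -/
def diag (n : M.carrier .nat) : M.carrier .nat :=
  M.recN ⊙ n ⊙ M.zero ⊙ eval (Env.nil _) (Term.lam (Term.lam
    (condT (subT (triT (.succ ⬝ v1)) (.succ ⬝ v0)) (.succ ⬝ v1) v1)))

@[simp]
theorem eval_diagT (n : Term Γ .nat) : eval e (diagT n) = diag (eval e n) := by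
  simp only [diagT, diag, eval]
  congr 1

theorem diag_zero : diag (M.zero : M.carrier .nat) = M.zero := by simp [diag]

open Classical in
theorem diag_succ (n : M.carrier .nat) : diag (M.succ ⊙ n) =
    if tri (M.succ ⊙ diag n) ≤ M.succ ⊙ n then M.succ ⊙ diag n else diag n := by
  simp [diag, eval, Env.cons, cond_eq_ite, le_iff_sub]

theorem Rep.diag {f : M.carrier .nat → M.carrier .nat} (hf : Rep f) : Rep fun n => diag (f n) :=
  .app (.app (.app (.const _) hf) (.const _)) (.const _)

theorem diag_spec (n : M.carrier .nat) : tri (diag n) ≤ n ∧ n < tri (M.succ ⊙ diag n) := by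
  refine Dec.induction (p := fun n => tri (diag n) ≤ n ∧ n < tri (M.succ ⊙ diag n))
    (.and (.le (.tri (.diag .id)) .id) (.lt .id (.tri (.app (.const _) (.diag .id)))))
    ⟨?_, ?_⟩ (fun n ih => ?_) n
  · simp [diag_zero, tri_zero]
  · exact (zero_le' _).trans_lt (tri_lt_tri_succ _)
  · rw [diag_succ]
    split_ifs with h
    · exact ⟨h, (succ_le_iff.2 ih.2).trans_lt (tri_lt_tri_succ _)⟩
    · exact ⟨ih.1.trans (lt_succ_self n).le, not_le.1 h⟩

/-- The intervals between consecutive triangular numbers are disjoint, so `n` determines its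
diagonal. This makes the pairing invertible. -/
theorem diag_eq {n s : M.carrier .nat} (h₁ : tri s ≤ n) (h₂ : n < tri (M.succ ⊙ s)) :
    diag n = s := by
  obtain ⟨h₃, h₄⟩ := diag_spec n
  rcases lt_trichotomy (diag n) s with h | h | h
  · exact (h₄.not_ge ((tri_mono (succ_le_iff.2 h)).trans h₁)).elim
  · exact h
  · exact (h₂.not_ge ((tri_mono (succ_le_iff.2 h)).trans h₃)).elim

theorem diag_pair (a b : M.carrier .nat) : diag (add (tri (add a b)) a) = add a b := by
  refine diag_eq (le_add_right _ _) ?_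
  rw [tri_succ]
  exact add_lt_add_left (lt_succ_iff.2 (le_add_right a b)) _

/-- The code of a sequence together with a number. -/
def code (R : M.carrier .seq) (k : M.carrier .nat) : M.carrier .one :=
  eval (Env.cons k (Env.cons R (Env.nil _))) (codeT v1 v0)

/-- The sequence of sets coded by `f`. -/
def decode (f : M.carrier .one) : M.carrier .seq := eval (Env.cons f (Env.nil _)) (decodeT v0)

theorem eval_predT_app (n : M.carrier .nat) : eval e predT ⊙ n = pred n := rfl

theorem eval_codeT (R : Term Γ .seq) (k : Term Γ .nat) :
    eval e (codeT R k) = code (eval e R) (eval e k) := by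
  refine M.ext fun n => ?_
  simp only [code, codeT, eval_lam, eval_condT, eval, eval_wk, Env.cons, fstT, sndPairT, eval_subT,
    eval_triT, eval_diagT, eval_predT_app]

theorem eval_decodeT (f : Term Γ .one) : eval e (decodeT f) = decode (eval e f) := by
  refine M.ext fun i => M.ext fun n => ?_
  simp only [decode, decodeT, eval_lam, eval_condT, eval, eval_wk, Env.cons, pairT, eval_addT,
    eval_triT, eval_oneT]

theorem code_zero (R : M.carrier .seq) (k : M.carrier .nat) : code R k ⊙ M.zero = k := by
  simp [code, codeT, eval, eval_wk, Env.cons]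

/-- Position `0` of the code holds `k`, so the pairs are shifted by one. The result is `R` itself,
by extensionality of the model, so a functional takes the same value at both. -/
theorem decode_code {R : M.carrier .seq} (hR : ∀ i, IsSet (R ⊙ i)) (k : M.carrier .nat) :
    decode (code R k) = R := by
  refine M.ext fun i => M.ext fun n => ?_
  have h : decode (code R k) ⊙ i ⊙ n = cond (R ⊙ i ⊙ n) M.zero one := by
    simp [decode, decodeT, code, codeT, eval, eval_wk, Env.cons, eval_predT_app, pairT, fstT,
      sndPairT, diag_pair, add_sub_cancel_left]
  rw [h, cond_eq_ite]
  rcases hR i n with h | h <;> simp [h]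

theorem isSet_decode (f : M.carrier .one) (i : M.carrier .nat) : IsSet (decode f ⊙ i) := by
  intro n
  simp only [decode, decodeT, eval_lam, eval_condT, cond_eq_ite, eval_oneT]
  split_ifs <;> simp [eval]

/-- The statement to be uniformized quantifies over sequences of sets and numbers, while choice is
available only from type `1`. Decoding a type `1` object always yields a sequence of sets, so the
premise of choice holds for every `f`; the matrix is quantifier-free, with `Φ₁` as a parameter. -/
theorem exists_isInfWitness {Φ₁ Φ₂ : M.carrier (.seq ⇒ .one)} (hΦ : IsUCOH Φ₁ Φ₂) :
    ∃ Ξ, IsInfWitness Φ₁ Ξ := by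
  obtain ⟨F, hF⟩ : ∃ F : M.carrier (.one ⇒ .nat ⇒ .nat), ∀ f l, F ⊙ f ⊙ l = M.zero ↔
      f ⊙ M.zero < l ∧ Φ₁ ⊙ decode f ⊙ l = one := by
    refine ⟨eval (Env.cons Φ₁ (Env.nil _)) (Term.lam (Term.lam (andT (ltT (v1 ⬝ .zero) v0)
      (eqT (v2 ⬝ decodeT v1 ⬝ v0) oneT)))), fun f l => ?_⟩
    rw [eval_lam, eval_lam, eval_andT, eval_ltT, eval_eqT]
    simp only [eval, eval_decodeT, Env.cons, eval_oneT]
  obtain ⟨Y, hY⟩ := qf_choice F fun f => by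
    simp only [hF]
    exact (hΦ (decode f) (isSet_decode f)).2.1 _
  simp only [hF] at hY
  refine ⟨eval (Env.cons Y (Env.nil _)) (Term.lam (Term.lam (v2 ⬝ codeT v1 v0))), fun R hR k => ?_⟩
  have := hY (code R k)
  rw [code_zero, decode_code hR] at this
  simpa [eval, eval_codeT, Env.cons] using this

end Model

/-! ### From `μ` to `UCOH` -/

section Terms

variable {Γ : Ctx} (μ : Term Γ .two) (R : Term Γ .seq)

/-- The truth value of: `n` and `m` lie in the same sets `R j` for `j < i`. -/
def simT (i n m : Term Γ .nat) : Term Γ .nat :=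
  notT (exT μ (andT (ltT v0 i.wk) (notT (eqT (R.wk ⬝ v0 ⬝ n.wk) (R.wk ⬝ v0 ⬝ m.wk)))))

/-- The truth value of: infinitely many numbers lie in the same sets `R j` for `j < i` as `m`. -/
def manyT (i m : Term Γ .nat) : Term Γ .nat :=
  notT (exT μ (notT (exT μ.wk (andT (ltT v1 v0) (simT μ.wk.wk R.wk.wk i.wk.wk v0 m.wk.wk)))))

/-- A number beyond `a` in the same sets `R j` for `j < i` as `a` that lies in the same sets `R j`
for `j ≤ i` as infinitely many others. -/
def nextT (i a : Term Γ .nat) : Term Γ .nat :=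
  μ ⬝ Term.lam (andT (ltT a.wk v0)
    (andT (simT μ.wk R.wk i.wk v0 a.wk) (manyT μ.wk R.wk (.succ ⬝ i.wk) v0)))

/-- The enumeration of a cohesive set. -/
def cohSeqT : Term Γ .one :=
  Term.lam (.recN ⬝ v0 ⬝ .zero ⬝ (Term.lam (Term.lam (nextT μ.wk.wk R.wk.wk v0 v1))).wk)

/-- The range of the enumeration. -/
def cohSetT : Term Γ .one :=
  Term.lam (condT (exT μ.wk (eqT ((cohSeqT μ R).wk.wk ⬝ v0) v1)) oneT .zero)

/-- The bounds beyond which the cohesive set is decided. -/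
def cohBoundT : Term Γ .one := Term.lam ((cohSeqT μ R).wk ⬝ (.succ ⬝ v0))

end Terms

namespace Model

variable {M : Model} {Γ : Ctx}

/-- The numbers `n` and `m` lie in the same sets `R j` for `j < i`. -/
def Sim (R : M.carrier .seq) (i n m : M.carrier .nat) : Prop :=
  ∀ j, j < i → R ⊙ j ⊙ n = R ⊙ j ⊙ m

/-- Infinitely many numbers lie in the same sets `R j` for `j < i` as `m`. -/
def Many (R : M.carrier .seq) (i m : M.carrier .nat) : Prop := ∀ k, ∃ l, k < l ∧ Sim R i l m

section Eval

variable (e : M.Env Γ) {μ : Term Γ .two} {R : Term Γ .seq}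

theorem eval_simT (hμ : IsMu (eval e μ)) {i n m : Term Γ .nat} :
    eval e (simT μ R i n m) = M.zero ↔
      Sim (eval e R) (eval e i) (eval e n) (eval e m) := by
  simp only [simT, eval_notT, eval_exT e hμ, eval_andT, eval_ltT, eval_eqT, eval, eval_wk,
    Env.cons, Sim, not_exists, not_and, not_not]

theorem eval_manyT (hμ : IsMu (eval e μ)) {i m : Term Γ .nat} :
    eval e (manyT μ R i m) = M.zero ↔
      Many (eval e R) (eval e i) (eval e m) := by
  rw [manyT, eval_notT, eval_exT e hμ]
  simp only [eval_notT, not_exists, not_not]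
  refine forall_congr' fun k => ?_
  rw [eval_exT _ (by rwa [eval_wk])]
  refine exists_congr fun l => ?_
  rw [eval_andT, eval_simT _ (by rwa [eval_wk, eval_wk])]
  simp only [eval_ltT, eval_wk, eval, Env.cons]

theorem eval_nextT (hμ : IsMu (eval e μ)) {i a : Term Γ .nat}
    (h : ∃ m, eval e a < m ∧ Sim (eval e R) (eval e i) m (eval e a) ∧
      Many (eval e R) (M.succ ⊙ eval e i) m) :
    eval e a < eval e (nextT μ R i a) ∧
      Sim (eval e R) (eval e i) (eval e (nextT μ R i a)) (eval e a) ∧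
      Many (eval e R) (M.succ ⊙ eval e i) (eval e (nextT μ R i a)) := by
  have key (m : M.carrier .nat) : eval e (Term.lam (andT (ltT a.wk v0)
      (andT (simT μ.wk R.wk i.wk v0 a.wk) (manyT μ.wk R.wk (.succ ⬝ i.wk) v0)))) ⊙ m = M.zero ↔
      eval e a < m ∧ Sim (eval e R) (eval e i) m (eval e a) ∧
        Many (eval e R) (M.succ ⊙ eval e i) m := by
    rw [eval_lam, eval_andT, eval_andT, eval_simT _ (by rwa [eval_wk]),
      eval_manyT _ (by rwa [eval_wk])]
    simp only [eval_ltT, eval_wk, eval, Env.cons]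
  obtain ⟨m, hm⟩ := h
  exact (key _).1 (hμ _ ⟨m, (key m).2 hm⟩)

end Eval

theorem sim_succ_iff {R : M.carrier .seq} {i n m : M.carrier .nat} :
    Sim R (M.succ ⊙ i) n m ↔ Sim R i n m ∧ R ⊙ i ⊙ n = R ⊙ i ⊙ m := by
  refine ⟨fun h => ⟨fun j hj => h j (hj.trans (lt_succ_self i)), h i (lt_succ_self i)⟩,
    fun h j hj => ?_⟩
  rcases (lt_succ_iff.1 hj).lt_or_eq with hj | rfl
  exacts [h.1 j hj, h.2]

/-- Pigeonhole. If no `m` works, each candidate `m` has a bound beyond which no number similar to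
`a` takes the same value under `R i`. Three candidates, each beyond the bounds of its predecessors,
would have pairwise distinct values, but `R i` is binary. -/
theorem Many.exists_next {R : M.carrier .seq} {i a : M.carrier .nat} (hR : IsSet (R ⊙ i))
    (h : Many R i a) : ∃ m, a < m ∧ Sim R i m a ∧ Many R (M.succ ⊙ i) m := by
  by_contra! hno
  have bound {m : M.carrier .nat} (hm : a < m) (hma : Sim R i m a) :
      ∃ k, ∀ l, k < l → Sim R i l a → R ⊙ i ⊙ l ≠ R ⊙ i ⊙ m := by
    have := hno m hm hma
    simp only [Many, not_forall, not_exists, not_and, sim_succ_iff] at this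
    obtain ⟨k, hk⟩ := this
    exact ⟨k, fun l hl hla => hk l hl fun j hj => (hla j hj).trans (hma j hj).symm⟩
  obtain ⟨m₀, hm₀, hs₀⟩ := h a
  obtain ⟨k₀, hk₀⟩ := bound hm₀ hs₀
  obtain ⟨m₁, hm₁, hs₁⟩ := h (max a k₀)
  obtain ⟨k₁, hk₁⟩ := bound ((le_max_left _ _).trans_lt hm₁) hs₁
  obtain ⟨m₂, hm₂, hs₂⟩ := h (max k₀ k₁)
  have h₁ := hk₀ m₁ ((le_max_right _ _).trans_lt hm₁) hs₁
  have h₂ := hk₀ m₂ ((le_max_left _ _).trans_lt hm₂) hs₂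
  have h₃ := hk₁ m₂ ((le_max_right _ _).trans_lt hm₂) hs₂
  rcases hR m₀ with h | h <;> rcases hR m₁ with h' | h' <;> rcases hR m₂ with h'' | h'' <;>
    simp_all

section Sequence

variable (e : M.Env Γ) {μ : Term Γ .two} {R : Term Γ .seq}

/-- The next value is found by `μ`, and `Many.exists_next` guarantees that this search has a
solution. -/
theorem cohSeqT_succ (hμ : IsMu (eval e μ)) {i : M.carrier .nat} (hR : IsSet (eval e R ⊙ i))
    (h : Many (eval e R) i (eval e (cohSeqT μ R) ⊙ i)) :
    eval e (cohSeqT μ R) ⊙ i < eval e (cohSeqT μ R) ⊙ (M.succ ⊙ i) ∧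
      Sim (eval e R) i (eval e (cohSeqT μ R) ⊙ (M.succ ⊙ i)) (eval e (cohSeqT μ R) ⊙ i) ∧
      Many (eval e R) (M.succ ⊙ i) (eval e (cohSeqT μ R) ⊙ (M.succ ⊙ i)) := by
  have hsucc : eval e (cohSeqT μ R) ⊙ (M.succ ⊙ i) =
      eval (Env.cons i (Env.cons (eval e (cohSeqT μ R) ⊙ i) e))
        (nextT μ.wk.wk R.wk.wk v0 v1) := by
    simp only [cohSeqT, eval_lam, eval, eval_wk, Env.cons, recN_succ]
  have := eval_nextT (μ := μ.wk.wk) (R := R.wk.wk) (i := v0) (a := v1)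
    (Env.cons i (Env.cons (eval e (cohSeqT μ R) ⊙ i) e)) (by simpa only [eval_wk] using hμ)
  rw [← hsucc] at this
  simp only [eval_wk] at this
  exact this (h.exists_next hR)

theorem many_cohSeqT (hμ : IsMu (eval e μ)) (hR : ∀ i, IsSet (eval e R ⊙ i))
    (i : M.carrier .nat) : Many (eval e R) i (eval e (cohSeqT μ R) ⊙ i) := by
  refine Dec.induction (p := fun i => Many (eval e R) i (eval e (cohSeqT μ R) ⊙ i))
    -- Being `Many` is not quantifier-free, but with `μ` it is the vanishing of a term, so induction
    -- applies. At `0` there is no `j < 0` to check.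
    ⟨_, Rep.eval e (manyT μ.wk R.wk v0 ((cohSeqT μ R).wk ⬝ v0)), fun i => ?_⟩ (fun k => ?_)
    (fun i ih => (cohSeqT_succ e hμ (hR i) ih).2.2) i
  · rw [eval_manyT _ (by rwa [eval_wk])]
    simp only [eval, eval_wk, Env.cons]
  · exact ⟨_, lt_succ_self k, fun j hj => (hj.not_ge (zero_le' j)).elim⟩

theorem cohSeqT_lt_succ (hμ : IsMu (eval e μ)) (hR : ∀ i, IsSet (eval e R ⊙ i))
    (i : M.carrier .nat) :
    eval e (cohSeqT μ R) ⊙ i < eval e (cohSeqT μ R) ⊙ (M.succ ⊙ i) :=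
  (cohSeqT_succ e hμ (hR i) (many_cohSeqT e hμ hR i)).1

theorem cohSeqT_mono (hμ : IsMu (eval e μ)) (hR : ∀ i, IsSet (eval e R ⊙ i))
    {i j : M.carrier .nat} (h : i ≤ j) :
    eval e (cohSeqT μ R) ⊙ i ≤ eval e (cohSeqT μ R) ⊙ j := by
  refine Dec.induction
    (p := fun j => i ≤ j → eval e (cohSeqT μ R) ⊙ i ≤ eval e (cohSeqT μ R) ⊙ j)
    (.imp (.le (.const _) .id) (.le (.const _) (.app (.const _) .id))) (fun h => ?_)
    (fun j ih h => ?_) j h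
  · rw [le_zero_iff.1 h]
  · rcases le_succ_iff.1 h with h | rfl
    · exact (ih h).trans (cohSeqT_lt_succ e hμ hR j).le
    · exact le_rfl

theorem le_cohSeqT (hμ : IsMu (eval e μ)) (hR : ∀ i, IsSet (eval e R ⊙ i))
    (i : M.carrier .nat) : i ≤ eval e (cohSeqT μ R) ⊙ i :=
  Dec.induction (p := fun i => i ≤ eval e (cohSeqT μ R) ⊙ i) (.le .id (.app (.const _) .id))
    (zero_le' _)
    (fun i ih => succ_le_iff.2 (ih.trans_lt (cohSeqT_lt_succ e hμ hR i))) i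

/-- A step from `j` to `j + 1` preserves membership in `R i` only for `i < j`, so the value is
settled from index `i + 1` on and not yet at `i`. -/
theorem cohSeqT_sim (hμ : IsMu (eval e μ)) (hR : ∀ i, IsSet (eval e R ⊙ i))
    {i j : M.carrier .nat} (h : M.succ ⊙ i ≤ j) :
    eval e R ⊙ i ⊙ (eval e (cohSeqT μ R) ⊙ j) =
      eval e R ⊙ i ⊙ (eval e (cohSeqT μ R) ⊙ (M.succ ⊙ i)) := by
  refine Dec.induction (p := fun j => M.succ ⊙ i ≤ j →
      eval e R ⊙ i ⊙ (eval e (cohSeqT μ R) ⊙ j) =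
        eval e R ⊙ i ⊙ (eval e (cohSeqT μ R) ⊙ (M.succ ⊙ i)))
    (.imp (.le (.const _) .id) (.eq (.app (.const _) (.app (.const _) .id)) (.const _)))
    (fun h => ?_) (fun j ih h => ?_) j h
  · exact (succ_ne_zero i (le_zero_iff.1 h)).elim
  · rcases le_succ_iff.1 h with h | h
    · rw [(cohSeqT_succ e hμ (hR j) (many_cohSeqT e hμ hR j)).2.1 i (succ_le_iff.1 h), ih h]
    · rw [h]

open Classical in
theorem cohSetT_app (hμ : IsMu (eval e μ)) (n : M.carrier .nat) :
    eval e (cohSetT μ R) ⊙ n =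
      if ∃ j, eval e (cohSeqT μ R) ⊙ j = n then one else M.zero := by
  rw [cohSetT, eval_lam, eval_condT, cond_eq_ite, eval_exT _ (by rwa [eval_wk])]
  simp only [eval_eqT, eval, eval_wk, Env.cons, eval_oneT]

theorem isCohesive_cohSetT (hμ : IsMu (eval e μ)) (hR : ∀ i, IsSet (eval e R ⊙ i))
    :
    IsCohesive (eval e R) (eval e (cohSetT μ R)) (eval e (cohBoundT μ R)) := by
  have hmem (n : M.carrier .nat) : eval e (cohSetT μ R) ⊙ n = one ↔
      ∃ j, eval e (cohSeqT μ R) ⊙ j = n := by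
    rw [cohSetT_app e hμ]
    split_ifs with h <;> simp [h, one_ne_zero.symm]
  have hbound (i : M.carrier .nat) : eval e (cohBoundT μ R) ⊙ i =
      eval e (cohSeqT μ R) ⊙ (M.succ ⊙ i) := by
    simp [cohBoundT, eval, eval_wk, Env.cons]
  have key {i n : M.carrier .nat} (hn : eval e (cohSetT μ R) ⊙ n = one)
      (hi : eval e (cohBoundT μ R) ⊙ i ≤ n) :
      eval e R ⊙ i ⊙ n = eval e R ⊙ i ⊙ (eval e (cohSeqT μ R) ⊙ (M.succ ⊙ i)) := by
    obtain ⟨j, rfl⟩ := (hmem n).1 hn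
    -- An index `j ≤ i` would put the element at or below `c i`, hence strictly below the bound `c
    -- (i+1)`.
    refine cohSeqT_sim e hμ hR (le_of_not_gt fun hj => ?_)
    rw [hbound] at hi
    have := cohSeqT_mono e hμ hR (lt_succ_iff.1 hj)
    exact (hi.trans this).not_gt (cohSeqT_lt_succ e hμ hR i)
  refine ⟨fun n => ?_, fun k => ?_, fun i => ?_⟩
  · rw [cohSetT_app e hμ]
    split_ifs <;> simp
  · exact ⟨_, (le_cohSeqT e hμ hR k).trans_lt (cohSeqT_lt_succ e hμ hR k), (hmem _).2 ⟨_, rfl⟩⟩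
  · by_cases h : eval e R ⊙ i ⊙ (eval e (cohSeqT μ R) ⊙ (M.succ ⊙ i)) = one
    · exact .inl fun n hn hi => by rw [key hn hi, h]
    · exact .inr fun n hn hi => by rwa [key hn hi]

end Sequence

end Model

/-! ### Closed terms and the main theorem -/

/-- The first component of the functional obtained from `μ`. -/
def cohSetFunT : Term [] (Ty.two ⇒ Ty.seq ⇒ Ty.one) :=
  .lam (.lam (cohSetT v1 v0))

/-- The second component of the functional obtained from `μ`. -/
def cohBoundFunT : Term [] (Ty.two ⇒ Ty.seq ⇒ Ty.one) :=
  .lam (.lam (cohBoundT v1 v0))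

namespace Model

variable {M : Model}

theorem isUCOH_of_isMu (e : M.Env []) {μ : M.carrier .two} (hμ : IsMu μ) :
    IsUCOH (eval e cohSetFunT ⊙ μ) (eval e cohBoundFunT ⊙ μ) := by
  intro R hR
  simp only [cohSetFunT, cohBoundFunT, eval_lam]
  exact isCohesive_cohSetT (μ := v1) (R := v0) (Env.cons R (Env.cons μ e)) hμ hR

end Model
end HigherOrderArith

open HigherOrderArith.Struct HigherOrderArith.Model in
theorem mainTheorem4 :
    -- the equivalence
    RCAωProves (UCOH.iff Mu2) ∧
    -- `(μ²) → UCOH` is explicit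
    (∃ s₁ s₂ : Term [] (Ty.two ⇒ Ty.seq ⇒ Ty.one),
      RCAωProves (.all .two
        (.imp (MUFor v0) (UCOHFor (s₁.wk ⬝ v0) (s₂.wk ⬝ v0))))) ∧
    -- `UCOH → (μ²)` is explicit, with the witness for infinitude from quantifier-free choice
    RCAωProves (.all (.seq ⇒ .one) (.all (.seq ⇒ .one)
      (.imp (UCOHFor v1 v0) (.ex (.seq ⇒ .one) (InfWitness v2 v0))))) ∧
    (∃ u : Term [] ((Ty.seq ⇒ Ty.one) ⇒ (Ty.seq ⇒ Ty.one) ⇒ (Ty.seq ⇒ Ty.one) ⇒ Ty.two),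
      RCAωProves (.all (.seq ⇒ .one) (.all (.seq ⇒ .one) (.all (.seq ⇒ .one)
        (.imp ((UCOHFor v2 v1).and (InfWitness v2 v0))
          (MUFor (u.wk.wk.wk ⬝ v2 ⬝ v1 ⬝ v0))))))) := by
  refine ⟨.of_forall_model fun M => ?_, ⟨cohSetFunT, cohBoundFunT, .of_forall_model fun M μ hμ => ?_⟩,
    .of_forall_model fun M Φ₁ Φ₂ hΦ => ?_, ⟨muT, .of_forall_model fun M Φ₁ Φ₂ Ξ h => ?_⟩⟩
  · simp only [UCOH, Mu2, sat_iff, sat_ex, sat_UCOHFor, sat_MUFor, eval, Env.cons]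
    constructor
    · rintro ⟨Φ₁, Φ₂, hΦ⟩
      obtain ⟨Ξ, hΞ⟩ := exists_isInfWitness hΦ
      exact ⟨_, isMu_of_isUCOH (Env.nil _) hΦ hΞ⟩
    · rintro ⟨μ, hμ⟩
      exact ⟨_, _, isUCOH_of_isMu (Env.nil _) hμ⟩
  · rw [sat_MUFor] at hμ
    rw [sat_UCOHFor]
    simp only [eval, eval_wk]
    exact isUCOH_of_isMu (Env.nil _) hμ
  · rw [sat_UCOHFor] at hΦ
    simp only [sat_ex, sat_InfWitness]
    exact exists_isInfWitness hΦ
  · rw [sat_and, sat_UCOHFor, sat_InfWitness] at h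
    rw [sat_MUFor]
    simp only [eval, eval_wk]
    exact isMu_of_isUCOH (Env.nil _) h.1 h.2
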